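/- Let $V:\mathbb{R}^2\to\mathbb{R}$ be a non-negative $C^1$ function such that, for some $C>0$ and $\beta>3$, $$|V(x)|+|x\cdot\nabla V(x)|\le C\,(1+|x|^2)^{-\beta/2}\qquad (x\in\mathbb{R}^2),$$ and put $W=2V+x\cdot\nabla V$. Let $-\Delta_V=-\Delta+V$ be the Schrödinger operator on the complex Hilbert space $L^2(\mathbb{R}^2)$ with domain $H^2(\mathbb{R}^2)$, let $(-\Delta_V)^{s/2}$ be its fractional power defined by the spectral theorem, and let $x\cdot\nabla$ act in $L^2(\mathbb{R}^2)$ in the sense of distributions, with domain $\{f\in L^2: x\cdot\nabla f\in L^2\}$. For $s>0$ define $$A(s)=s(-\Delta_V)^{s/2}+\left[x\cdot\nabla,(-\Delta_V)^{s/2}\right],\qquad [B,D]=BD-DB,$$ on its natural domain (all $f$ for which every term is defined in $L^2$). Let $0<s<2$ and let $c(s)$ be given by $c(s)^{-1}=\int_0^\infty\tau^{s/2-1}(\tau+1)^{-1}\,d\tau$, a convergent integral. Then $\tau-\Delta_V$ has a bounded inverse on $L^2(\mathbb{R}^2)$ for every $\tau>0$, the domain of $A(s)$ contains the Schwartz functions,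 the integral $$\int_0^\infty\tau^{s/2}(\tau-\Delta_V)^{-1}W(\tau-\Delta_V)^{-1}\,d\tau$$ converges absolutely in the operator norm of $L^2(\mathbb{R}^2)$, and $$A(s)f=c(s)\left(\int_0^\infty\tau^{s/2}(\tau-\Delta_V)^{-1}W(\tau-\Delta_V)^{-1}\,d\tau\right)f\qquad\text{for every } f \text{ in the domain of } A(s).$$ -/

import Mathlib

open MeasureTheory Set
open scoped SchwartzMap LineDeriv Laplacian ENNReal

noncomputable section

namespace Schrodinger2D

/-! ### Unbounded operators on a complex Hilbert space -/

section Abstract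

variable {𝓗 : Type*} [NormedAddCommGroup 𝓗] [InnerProductSpace ℂ 𝓗]

/-- The graph of the product `B D` of two unbounded operators. -/
def mulGraph (B D : 𝓗 →ₗ.[ℂ] 𝓗) : Submodule ℂ (𝓗 × 𝓗) where
  carrier := {p | ∃ y, (p.1, y) ∈ D.graph ∧ (y, p.2) ∈ B.graph}
  add_mem' := by
    rintro p q ⟨y, h1, h2⟩ ⟨z, h3, h4⟩
    exact ⟨y + z, D.graph.add_mem h1 h3, B.graph.add_mem h2 h4⟩
  zero_mem' := ⟨0, D.graph.zero_mem, B.graph.zero_mem⟩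
  smul_mem' := by
    rintro a p ⟨y, h1, h2⟩
    exact ⟨a • y, D.graph.smul_mem a h1, B.graph.smul_mem a h2⟩

/-- The product `B D` of two unbounded operators, `f ↦ B (D f)`, on its natural domain
`{f ∈ D(D) | D f ∈ D(B)}`. -/
def mulPMap (B D : 𝓗 →ₗ.[ℂ] 𝓗) : 𝓗 →ₗ.[ℂ] 𝓗 := (mulGraph B D).toLinearPMap

theorem mem_graph_mulPMap (B D : 𝓗 →ₗ.[ℂ] 𝓗) (f g : 𝓗) :
    (f, g) ∈ (mulPMap B D).graph ↔ ∃ y, (f, y) ∈ D.graph ∧ (y, g) ∈ B.graph := by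
  unfold mulPMap
  rw [Submodule.toLinearPMap_graph_eq]
  · rfl
  · rintro ⟨x, z⟩ ⟨y, h1, h2⟩ h0
    have hy : y = 0 := D.graph_fst_eq_zero_snd h1 h0
    exact B.graph_fst_eq_zero_snd h2 hy

/-- The commutator `[B, D] = B D - D B` on its natural domain `D(B D) ∩ D(D B)`. -/
def commutator (B D : 𝓗 →ₗ.[ℂ] 𝓗) : 𝓗 →ₗ.[ℂ] 𝓗 := mulPMap B D - mulPMap D B

/-- The bounded operator `R` is the two-sided inverse of `τ + H : D(H) → 𝓗`. -/
def IsResolvent (H : 𝓗 →ₗ.[ℂ] 𝓗) (τ : ℝ) (R : 𝓗 →L[ℂ] 𝓗) : Prop :=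
  (∀ g : 𝓗, ∃ h : R g ∈ H.domain, (τ : ℂ) • R g + H ⟨R g, h⟩ = g) ∧
    ∀ f : H.domain, R ((τ : ℂ) • (f : 𝓗) + H f) = f

theorem IsResolvent.unique {H : 𝓗 →ₗ.[ℂ] 𝓗} {τ : ℝ} {R R' : 𝓗 →L[ℂ] 𝓗}
    (h : IsResolvent H τ R) (h' : IsResolvent H τ R') : R = R' := by
  ext g
  obtain ⟨hg, e⟩ := h.1 g
  have := h'.2 ⟨R g, hg⟩
  simp only [e] at this
  exact this.symm

open Classical in
/-- The bounded operator `(τ + H)⁻¹` (zero if `τ + H` has no bounded inverse). -/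
def resolventOp (H : 𝓗 →ₗ.[ℂ] 𝓗) (τ : ℝ) : 𝓗 →L[ℂ] 𝓗 :=
  if h : ∃ R, IsResolvent H τ R then h.choose else 0

theorem resolventOp_eq {H : 𝓗 →ₗ.[ℂ] 𝓗} {τ : ℝ} {R : 𝓗 →L[ℂ] 𝓗} (h : IsResolvent H τ R) :
    resolventOp H τ = R := by
  have hex : ∃ R, IsResolvent H τ R := ⟨R, h⟩
  unfold resolventOp
  rw [dif_pos hex]
  exact hex.choose_spec.unique h

/-- The fractional power `H ^ a` (`a > 0`) of a non-negative self-adjoint operator `H`, in the sense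
of the spectral theorem. The bounded self-adjoint operator `R = (1 + H)⁻¹` satisfies `0 ≤ R ≤ 1`
and a spectral value `λ ≥ 0` of `H` corresponds to the spectral value `r = (1 + λ)⁻¹` of `R`, with
`λ ^ a = (1 - r) ^ a / r ^ a`. By the functional calculus of `R`, the operator `H ^ a`
has domain `Ran (R ^ a) = D((1 + H) ^ a)`, and it maps `R ^ a g` to `(1 - R) ^ a g`. -/
def fracPow [CompleteSpace 𝓗] (H : 𝓗 →ₗ.[ℂ] 𝓗) (a : ℝ) : 𝓗 →ₗ.[ℂ] 𝓗 :=
  (LinearMap.range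
    ((cfc (fun r : ℝ => r ^ a) (resolventOp H 1) : 𝓗 →L[ℂ] 𝓗).toLinearMap.prod
      (cfc (fun r : ℝ => (1 - r) ^ a) (resolventOp H 1) : 𝓗 →L[ℂ] 𝓗).toLinearMap)).toLinearPMap

end Abstract

/-! ### Operators on `L²(ℝ²)` -/

/-- The plane `ℝ²` with its Euclidean norm. -/
abbrev Plane : Type := EuclideanSpace ℝ (Fin 2)

/-- The complex Hilbert space `L²(ℝ²)`. -/
abbrev L2 : Type := Lp ℂ 2 (volume : Measure Plane)

/-- The pairs `(f, g)` of `L²` functions with `T f = g` in the sense of tempered distributions. -/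
def l2Graph (T : 𝓢'(Plane, ℂ) →L[ℂ] 𝓢'(Plane, ℂ)) : Submodule ℂ (L2 × L2) where
  carrier := {p | T (Lp.toTemperedDistributionCLM ℂ volume 2 p.1) =
    Lp.toTemperedDistributionCLM ℂ volume 2 p.2}
  add_mem' := by
    intro p q hp hq
    simp only [mem_ofPred_eq, Prod.fst_add, Prod.snd_add, map_add] at *
    rw [hp, hq]
  zero_mem' := by simp only [mem_ofPred_eq, Prod.fst_zero, Prod.snd_zero, map_zero]
  smul_mem' := by
    intro a p hp
    simp only [mem_ofPred_eq, Prod.smul_fst, Prod.smul_snd, map_smul] at *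
    rw [hp]

/-- The maximal realization in `L²(ℝ²)` of an operator `T` acting on tempered distributions:
its domain is `{f ∈ L² | T f ∈ L²}`. -/
def l2Realization (T : 𝓢'(Plane, ℂ) →L[ℂ] 𝓢'(Plane, ℂ)) : L2 →ₗ.[ℂ] L2 :=
  (l2Graph T).toLinearPMap

theorem mem_graph_l2Realization (T : 𝓢'(Plane, ℂ) →L[ℂ] 𝓢'(Plane, ℂ)) (f g : L2) :
    (f, g) ∈ (l2Realization T).graph ↔
      T (Lp.toTemperedDistributionCLM ℂ volume 2 f) = Lp.toTemperedDistributionCLM ℂ volume 2 g := by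
  unfold l2Realization
  rw [Submodule.toLinearPMap_graph_eq]
  · rfl
  · rintro ⟨x, y⟩ h h0
    change T (Lp.toTemperedDistributionCLM ℂ volume 2 x) =
      Lp.toTemperedDistributionCLM ℂ volume 2 y at h
    change x = 0 at h0
    rw [h0, map_zero, map_zero] at h
    have hy : y ∈ (Lp.toTemperedDistributionCLM ℂ (volume : Measure Plane) 2).ker := h.symm
    rw [Lp.ker_toTemperedDistributionCLM_eq_bot] at hy
    exact hy

/-- The Laplacian `Δ` on `L²(ℝ²)`, with domain `{f ∈ L² | Δ f ∈ L²} = H²(ℝ²)`. -/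
def laplacianL2 : L2 →ₗ.[ℂ] L2 :=
  l2Realization (LineDeriv.laplacianCLM ℂ Plane 𝓢'(Plane, ℂ))

/-- The operator `x · ∇ = ∑ᵢ xᵢ ∂ᵢ` on tempered distributions. -/
def xDotGradDistr : 𝓢'(Plane, ℂ) →L[ℂ] 𝓢'(Plane, ℂ) :=
  ∑ i : Fin 2, TemperedDistribution.smulLeftCLM ℂ (fun x : Plane => ((x i : ℝ) : ℂ)) ∘L
    LineDeriv.lineDerivOpCLM ℂ 𝓢'(Plane, ℂ) (EuclideanSpace.single i (1 : ℝ))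

/-- The operator `x · ∇` on `L²(ℝ²)`, with domain `{f ∈ L² | x · ∇ f ∈ L²}`. -/
def xDotGrad : L2 →ₗ.[ℂ] L2 := l2Realization xDotGradDistr

open Classical in
/-- The bounded operator on `L²(ℝ²)` of multiplication by the essentially bounded function `W`
(zero if `W` is not in `L^∞`). -/
def mulOp (W : Plane → ℝ) : L2 →L[ℂ] L2 :=
  if h : MemLp (fun x => ((W x : ℝ) : ℂ)) ∞ volume then
    (ContinuousLinearMap.mul ℂ ℂ).holderL volume ∞ 2 2 (h.toLp _)
  else 0

theorem coeFn_mulOp {W : Plane → ℝ} (h : MemLp (fun x => ((W x : ℝ) : ℂ)) ∞ volume) (f : L2) :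
    mulOp W f =ᵐ[volume] fun x => ((W x : ℝ) : ℂ) * f x := by
  unfold mulOp
  rw [dif_pos h, ContinuousLinearMap.holderL_apply_apply]
  filter_upwards [ContinuousLinearMap.coeFn_holder (r := 2) (ContinuousLinearMap.mul ℂ ℂ)
    (h.toLp _) f, h.coeFn_toLp] with x h1 h2
  rw [h1, h2]
  rfl

/-- The Schrödinger operator `-Δ_V = -Δ + V` on `L²(ℝ²)`, with domain `H²(ℝ²)`
(for bounded `V`). -/
def negLapV (V : Plane → ℝ) : L2 →ₗ.[ℂ] L2 :=
  (mulOp V).toLinearMap +ᵥ (-laplacianL2)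

/-- The resolvent `(τ - Δ_V)⁻¹`. -/
def res (V : Plane → ℝ) (τ : ℝ) : L2 →L[ℂ] L2 := resolventOp (negLapV V) τ

/-- `A(s) = s (-Δ_V)^{s/2} + [x · ∇, (-Δ_V)^{s/2}]` on its natural domain. -/
def opA (V : Plane → ℝ) (s : ℝ) : L2 →ₗ.[ℂ] L2 :=
  (s : ℂ) • fracPow (negLapV V) (s / 2) + commutator xDotGrad (fracPow (negLapV V) (s / 2))

/-- `W = 2 V + x · ∇ V`. -/
def potW (V : Plane → ℝ) (x : Plane) : ℝ := 2 * V x + fderiv ℝ V x x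

/-- The constant `c(s)`, with `c(s)⁻¹ = ∫₀^∞ τ^{s/2 - 1} (τ + 1)⁻¹ dτ`. -/
def cConst (s : ℝ) : ℝ := (∫ τ in Ioi (0 : ℝ), τ ^ (s / 2 - 1) * (τ + 1)⁻¹)⁻¹

/-- The integrand `τ^{s/2} (τ - Δ_V)⁻¹ W (τ - Δ_V)⁻¹`, a bounded operator on `L²(ℝ²)`. -/
def integrand (V : Plane → ℝ) (s τ : ℝ) : L2 →L[ℂ] L2 :=
  ((τ ^ (s / 2) : ℝ) : ℂ) • (res V τ ∘L mulOp (potW V) ∘L res V τ)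

end Schrodinger2D

end

/-! Write H = -Δ_V, D = x·∇, R_τ = (τ + H)⁻¹ and a = s/2. Scaling gives [D, H] = -2H + W, hence [D,
R_τ] = 2 R_τ H R_τ - R_τ W R_τ. Since R_τ H = 1 - τ R_τ, this becomes [D, R_τ H] = -2τ R_τ² H + τ
R_τ W R_τ. Inserting it into H^a = c(s) ∫ τ^(a-1) R_τ H dτ and using c(s) ∫ τ^a R_τ² H dτ = a H^a
yields [D, H^a] = -s H^a + c(s) ∫ τ^a R_τ W R_τ dτ, which is the formula. Four points need care.

Fractional powers: R_τ is a function of R_1, so both integral identities reduce to scalar integrals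
under the continuous functional calculus of R_1 (`integrableOn_and_integral_symbol`).

Convergence: the bound ‖R_τ W R_τ‖ ≤ M τ⁻² suffices at infinity but not at 0. There the decay of W
enters through a Hardy-type inequality, which in the plane costs a small power τ^(-ε)
(`weighted_form_bound_schwartz`, `norm_res_mulOp_res_le`).

The resolvent commutator: D is handled through the unitary dilations f ↦ eᵗ f(eᵗ x), whose generator
is D + 1. Differentiating the dilated resolvent equation shows that R_τ preserves differentiability
along the dilations, and it computes the derivative (`tendsto_dilQuot_res`). Integrating in τ
against test functions gives the formula on Schwartz functions (`fracKernel_mem_graph_xDotGrad`).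

The full domain of A(s): H^a and the operator integral are symmetric, and D* = -D - 2 holds between
vectors of the maximal domain of D (`inner_xDotGrad`). The formula for Schwartz ψ therefore passes
by duality to every f in the domain, and no core for A(s) is needed. -/

noncomputable section

namespace Schrodinger2D

open Filter Topology

/-! ### Non-negative self-adjoint operators and their resolvents -/

section Abstract

variable {𝓗 : Type*} [NormedAddCommGroup 𝓗] [InnerProductSpace ℂ 𝓗]

/-- A symmetric non-negative operator all of whose shifts by `τ > 0` have a bounded inverse. -/
structure IsNonnegSelfAdjoint (H : 𝓗 →ₗ.[ℂ] 𝓗) : Prop where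
  symm : ∀ f g : H.domain, inner ℂ (H f) (g : 𝓗) = inner ℂ (f : 𝓗) (H g)
  nonneg : ∀ f : H.domain, 0 ≤ (inner ℂ (f : 𝓗) (H f)).re
  exists_res : ∀ τ : ℝ, 0 < τ → ∃ R, IsResolvent H τ R

theorem re_inner_ofReal_smul_right (τ : ℝ) (f g : 𝓗) :
    (inner ℂ f ((τ : ℂ) • g)).re = τ * (inner ℂ f g).re := by
  rw [inner_smul_right, Complex.re_ofReal_mul]

theorem re_inner_self (f : 𝓗) : (inner ℂ f f).re = ‖f‖ ^ 2 := by
  rw [inner_self_eq_norm_sq_to_K]; norm_cast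

/-- Coercivity: expand Re⟨f, τf + h⟩ and apply Cauchy–Schwarz. With h = H f this is the source of
every bound ‖R_τ‖ ≤ τ⁻¹. -/
theorem norm_le_of_shift {τ : ℝ} {f h : 𝓗} (hn : 0 ≤ (inner ℂ f h).re) :
    τ * ‖f‖ ≤ ‖(τ : ℂ) • f + h‖ := by
  rcases eq_or_ne f 0 with rfl | hf
  · simp
  have h1 : τ * ‖f‖ ^ 2 ≤ (inner ℂ f ((τ : ℂ) • f + h)).re := by
    rw [inner_add_right, Complex.add_re, re_inner_ofReal_smul_right, re_inner_self]
    linarith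
  have h2 : (inner ℂ f ((τ : ℂ) • f + h)).re ≤ ‖f‖ * ‖(τ : ℂ) • f + h‖ :=
    (Complex.re_le_norm _).trans (norm_inner_le_norm _ _)
  have hf0 : 0 < ‖f‖ := norm_pos_iff.2 hf
  have : ‖f‖ * (τ * ‖f‖) ≤ ‖f‖ * ‖(τ : ℂ) • f + h‖ := by nlinarith
  exact le_of_mul_le_mul_left this hf0

/-- A closed non-negative operator whose shift by `τ > 0` has dense range has a resolvent
at `τ`. -/
theorem exists_isResolvent [CompleteSpace 𝓗] (H : 𝓗 →ₗ.[ℂ] 𝓗)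
    (hcl : IsClosed (H.graph : Set (𝓗 × 𝓗)))
    (hn : ∀ f : H.domain, 0 ≤ (inner ℂ (f : 𝓗) (H f)).re) {τ : ℝ} (hτ : 0 < τ)
    (hd : ∀ g : 𝓗, (∀ f : H.domain, inner ℂ ((τ : ℂ) • (f : 𝓗) + H f) g = 0) → g = 0) :
    ∃ R, IsResolvent H τ R := by
  have : CompleteSpace H.graph := hcl.completeSpace_coe
  -- On the graph, a Banach space because it is closed, τ + H is a bounded map. Coercivity bounds
  -- both components of the graph norm by ‖T p‖ (the second one through T p - τ p.1), so the range
  -- is closed, and `hd` makes it everything.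
  let T : H.graph →L[ℂ] 𝓗 :=
    ((τ : ℂ) • ContinuousLinearMap.fst ℂ 𝓗 𝓗 + ContinuousLinearMap.snd ℂ 𝓗 𝓗) ∘L
      H.graph.subtypeL
  have hT : ∀ p : H.graph, T p = (τ : ℂ) • p.1.1 + p.1.2 := fun p => rfl
  have hnn : ∀ p : H.graph, 0 ≤ (inner ℂ p.1.1 p.1.2).re := by
    rintro ⟨p, hp⟩
    obtain ⟨y, hy1, hy2⟩ := (LinearPMap.mem_graph_iff H).1 hp
    rw [← hy1, ← hy2]
    exact hn y
  have hb1 : ∀ p : H.graph, ‖p.1.1‖ ≤ τ⁻¹ * ‖T p‖ := by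
    intro p
    have := norm_le_of_shift (τ := τ) (hnn p)
    rw [hT, inv_mul_eq_div, le_div_iff₀ hτ, mul_comm]
    exact this
  have hb2 : ∀ p : H.graph, ‖p.1.2‖ ≤ 2 * ‖T p‖ := by
    intro p
    have h1 := norm_le_of_shift (τ := τ) (hnn p)
    have h2 : p.1.2 = T p - (τ : ℂ) • p.1.1 := by rw [hT]; abel
    rw [h2]
    refine (norm_sub_le _ _).trans ?_
    rw [norm_smul, Complex.norm_real, Real.norm_of_nonneg hτ.le]
    rw [hT] at *
    linarith
  have hanti : AntilipschitzWith (Real.toNNReal (max τ⁻¹ 2)) T := by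
    refine AddMonoidHomClass.antilipschitz_of_bound T fun p => ?_
    rw [Real.coe_toNNReal _ (by positivity)]
    change max ‖p.1.1‖ ‖p.1.2‖ ≤ _
    refine max_le ((hb1 p).trans ?_) ((hb2 p).trans ?_) <;> gcongr
    · exact le_max_left _ _
    · exact le_max_right _ _
  have hker : (T : H.graph →ₗ[ℂ] 𝓗).ker = ⊥ := LinearMap.ker_eq_bot.2 hanti.injective
  have hclR : IsClosed ((T : H.graph →ₗ[ℂ] 𝓗).range : Set 𝓗) := by
    rw [LinearMap.coe_range]
    exact hanti.isClosed_range T.uniformContinuous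
  have hran : (T : H.graph →ₗ[ℂ] 𝓗).range = ⊤ := by
    have hc : CompleteSpace (T : H.graph →ₗ[ℂ] 𝓗).range := hclR.completeSpace_coe
    rw [← Submodule.orthogonal_eq_bot_iff, Submodule.eq_bot_iff]
    intro g hg
    refine hd g fun f => ?_
    exact (Submodule.mem_orthogonal _ g).1 hg _ ⟨⟨_, H.mem_graph f⟩, rfl⟩
  let e := ContinuousLinearEquiv.ofBijective T hker hran
  refine ⟨ContinuousLinearMap.fst ℂ 𝓗 𝓗 ∘L H.graph.subtypeL ∘L (e.symm : 𝓗 →L[ℂ] H.graph),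
    fun g => ?_, fun f => ?_⟩
  · have h1 : T (e.symm g) = g := e.apply_symm_apply g
    obtain ⟨y, hy1, hy2⟩ := (LinearPMap.mem_graph_iff H).1 (e.symm g).2
    have hmem : (e.symm g).1.1 ∈ H.domain := hy1 ▸ y.2
    refine ⟨hmem, ?_⟩
    have : (⟨(e.symm g).1.1, hmem⟩ : H.domain) = y := Subtype.ext hy1.symm
    change (τ : ℂ) • (e.symm g).1.1 + H ⟨(e.symm g).1.1, hmem⟩ = g
    rw [this, hy2]
    exact h1
  · have : e ⟨_, H.mem_graph f⟩ = (τ : ℂ) • (f : 𝓗) + H f := rfl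
    rw [← this]
    change ((e.symm (e ⟨_, H.mem_graph f⟩)).1).1 = f
    rw [e.symm_apply_apply]

namespace IsNonnegSelfAdjoint

variable {H : 𝓗 →ₗ.[ℂ] 𝓗}

theorem isResolvent (hH : IsNonnegSelfAdjoint H) {τ : ℝ} (hτ : 0 < τ) :
    IsResolvent H τ (resolventOp H τ) := by
  obtain ⟨R, hR⟩ := hH.exists_res τ hτ
  rw [resolventOp_eq hR]
  exact hR

/-- `H R_τ g = g - τ R_τ g`. -/
theorem res_mem_graph (hH : IsNonnegSelfAdjoint H) {τ : ℝ} (hτ : 0 < τ) (g : 𝓗) :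
    (resolventOp H τ g, g - (τ : ℂ) • resolventOp H τ g) ∈ H.graph := by
  obtain ⟨h, e⟩ := (hH.isResolvent hτ).1 g
  rw [LinearPMap.mem_graph_iff]
  exact ⟨⟨_, h⟩, rfl, by rw [eq_sub_iff_add_eq, add_comm]; exact e⟩

theorem res_shift (hH : IsNonnegSelfAdjoint H) {τ : ℝ} (hτ : 0 < τ) {f h : 𝓗}
    (hf : (f, h) ∈ H.graph) :
    resolventOp H τ ((τ : ℂ) • f + h) = f := by
  obtain ⟨y, hy1, hy2⟩ := (LinearPMap.mem_graph_iff H).1 hf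
  have := (hH.isResolvent hτ).2 y
  simp only at hy1 hy2
  rwa [hy1, hy2] at this

theorem graph_symm (hH : IsNonnegSelfAdjoint H) {f h f' h' : 𝓗} (hf : (f, h) ∈ H.graph)
    (hf' : (f', h') ∈ H.graph) :
    inner ℂ h f' = inner ℂ f h' := by
  obtain ⟨y, hy1, hy2⟩ := (LinearPMap.mem_graph_iff H).1 hf
  obtain ⟨z, hz1, hz2⟩ := (LinearPMap.mem_graph_iff H).1 hf'
  simp only at hy1 hy2 hz1 hz2
  rw [← hy1, ← hy2, ← hz1, ← hz2]
  exact hH.symm y z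

theorem graph_nonneg (hH : IsNonnegSelfAdjoint H) {f h : 𝓗} (hf : (f, h) ∈ H.graph) :
    0 ≤ (inner ℂ f h).re := by
  obtain ⟨y, hy1, hy2⟩ := (LinearPMap.mem_graph_iff H).1 hf
  simp only at hy1 hy2
  rw [← hy1, ← hy2]
  exact hH.nonneg y

theorem norm_res_apply_le (hH : IsNonnegSelfAdjoint H) {τ : ℝ} (hτ : 0 < τ) (g : 𝓗) :
    ‖resolventOp H τ g‖ ≤ τ⁻¹ * ‖g‖ := by
  have h := norm_le_of_shift (τ := τ) (hH.graph_nonneg (hH.res_mem_graph hτ g))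
  rw [add_sub_cancel] at h
  rwa [inv_mul_eq_div, le_div_iff₀ hτ, mul_comm]

theorem norm_res_le (hH : IsNonnegSelfAdjoint H) {τ : ℝ} (hτ : 0 < τ) : ‖resolventOp H τ‖ ≤ τ⁻¹ :=
  ContinuousLinearMap.opNorm_le_bound _ (by positivity) (hH.norm_res_apply_le hτ)

theorem inner_res (hH : IsNonnegSelfAdjoint H) {τ : ℝ} (hτ : 0 < τ) (g h : 𝓗) :
    inner ℂ (resolventOp H τ g) h = inner ℂ g (resolventOp H τ h) := by
  have := hH.graph_symm (hH.res_mem_graph hτ g) (hH.res_mem_graph hτ h)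
  rw [inner_sub_left, inner_sub_right, inner_smul_left, inner_smul_right, Complex.conj_ofReal]
    at this
  exact (sub_left_inj.1 this).symm

theorem inner_res_nonneg (hH : IsNonnegSelfAdjoint H) {τ : ℝ} (hτ : 0 < τ) (g : 𝓗) :
    0 ≤ (inner ℂ (resolventOp H τ g) g).re := by
  have h := hH.graph_nonneg (hH.res_mem_graph hτ g)
  rw [inner_sub_right, Complex.sub_re, re_inner_ofReal_smul_right, re_inner_self] at h
  have : 0 ≤ τ * ‖resolventOp H τ g‖ ^ 2 := by positivity
  linarith

theorem res_injective (hH : IsNonnegSelfAdjoint H) {τ : ℝ} (hτ : 0 < τ) {g : 𝓗}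
    (h : resolventOp H τ g = 0) : g = 0 := by
  have h1 := hH.res_mem_graph hτ g
  rw [h, smul_zero, sub_zero] at h1
  exact H.graph_fst_eq_zero_snd h1 rfl

/-- The first resolvent identity: apply R_σ to (σ + H) R_τ g = g + (σ - τ) R_τ g. -/
theorem res_sub_res (hH : IsNonnegSelfAdjoint H) {σ τ : ℝ} (hσ : 0 < σ) (hτ : 0 < τ) :
    resolventOp H σ - resolventOp H τ =
      ((τ - σ : ℝ) : ℂ) • (resolventOp H σ ∘L resolventOp H τ) := by
  ext g
  have h := hH.res_shift hσ (hH.res_mem_graph hτ g)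
  rw [map_add, map_sub, map_smul, map_smul] at h
  simp only [sub_apply, smul_apply, ContinuousLinearMap.comp_apply, Complex.ofReal_sub, sub_smul]
  linear_combination (norm := module) h

theorem continuousOn_res (hH : IsNonnegSelfAdjoint H) :
    ContinuousOn (fun τ => resolventOp H τ) (Ioi 0) := by
  intro τ hτ
  have hτ' : (0 : ℝ) < τ := hτ
  refine ContinuousAt.continuousWithinAt ?_
  rw [ContinuousAt, tendsto_iff_norm_sub_tendsto_zero]
  have hb : ∀ᶠ σ in 𝓝 τ, ‖resolventOp H σ - resolventOp H τ‖ ≤ |τ - σ| * ((τ / 2)⁻¹ * τ⁻¹) := by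
    filter_upwards [lt_mem_nhds (half_lt_self hτ')] with σ hσ
    have hσ0 : 0 < σ := (half_pos hτ').trans hσ
    rw [hH.res_sub_res hσ0 hτ', norm_smul, Complex.norm_real, Real.norm_eq_abs]
    gcongr
    refine (ContinuousLinearMap.opNorm_comp_le _ _).trans ?_
    gcongr
    · refine (hH.norm_res_le hσ0).trans ?_
      gcongr
    · exact hH.norm_res_le hτ'
  refine squeeze_zero' (Eventually.of_forall fun _ => norm_nonneg _) hb ?_
  have : Continuous fun σ : ℝ => |τ - σ| * ((τ / 2)⁻¹ * τ⁻¹) := by fun_prop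
  simpa using this.tendsto τ

/-- This is 1 - R_1 = H R_1 read on f = R_1 (f + h). It converts identities between bounded
functions of R_1 into statements about H f. -/
theorem one_sub_res_shift (hH : IsNonnegSelfAdjoint H) {f h : 𝓗} (hf : (f, h) ∈ H.graph) :
    (1 - resolventOp H 1) (f + h) = h := by
  have := hH.res_shift one_pos hf
  rw [Complex.ofReal_one, one_smul] at this
  simp [this]

variable [CompleteSpace 𝓗]

theorem isSelfAdjoint_res (hH : IsNonnegSelfAdjoint H) {τ : ℝ} (hτ : 0 < τ) :
    IsSelfAdjoint (resolventOp H τ) :=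
  ContinuousLinearMap.isSelfAdjoint_iff_isSymmetric.2 fun g h => hH.inner_res hτ g h

theorem spectrum_res_one (hH : IsNonnegSelfAdjoint H) :
    spectrum ℝ (resolventOp H 1) ⊆ Icc 0 1 := by
  have h0 : 0 ≤ resolventOp H 1 := by
    rw [ContinuousLinearMap.nonneg_iff_isPositive, ContinuousLinearMap.isPositive_def]
    exact ⟨fun g h => hH.inner_res one_pos g h, fun g => hH.inner_res_nonneg one_pos g⟩
  have h1 : resolventOp H 1 ≤ 1 := by
    rw [← sub_nonneg, ContinuousLinearMap.nonneg_iff_isPositive, ContinuousLinearMap.isPositive_def]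
    refine ⟨fun g h => ?_, fun g => ?_⟩
    · simp only [ContinuousLinearMap.coe_coe, sub_apply, inner_sub_left, inner_sub_right,
        hH.inner_res one_pos, one_apply_eq_self]
    · have h := hH.graph_nonneg (hH.res_mem_graph one_pos g)
      rw [Complex.ofReal_one, one_smul] at h
      change 0 ≤ (inner ℂ (g - resolventOp H 1 g) g).re
      -- Splitting g = R g + (g - R g), where g - R g = H R g, leaves the form of H at R g plus a
      -- square.
      have e : inner ℂ (g - resolventOp H 1 g) g =
          inner ℂ (g - resolventOp H 1 g) (resolventOp H 1 g) +
          inner ℂ (g - resolventOp H 1 g) (g - resolventOp H 1 g) := by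
        rw [← inner_add_right, add_sub_cancel]
      rw [e, Complex.add_re, re_inner_self, ← inner_conj_symm, Complex.conj_re]
      positivity
  exact fun x hx => ⟨spectrum_nonneg_of_nonneg h0 hx, (CFC.le_one_iff (R := ℝ) _).1 h1 x hx⟩

end IsNonnegSelfAdjoint

end Abstract

end Schrodinger2D

end

noncomputable section

namespace Schrodinger2D

open Filter Topology

/-! ### Scalar integrals -/

section Scalar

theorem integrableOn_rpow_Ioc {p : ℝ} (hp : -1 < p) :
    IntegrableOn (fun τ : ℝ => τ ^ p) (Ioc 0 1) := by
  rw [integrableOn_Ioc_iff_integrableOn_Ioo]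
  exact (intervalIntegral.integrableOn_Ioo_rpow_iff one_pos).2 hp

theorem integrableOn_rpow_mul_inv {a : ℝ} (h0 : 0 < a) (h1 : a < 1) :
    IntegrableOn (fun τ : ℝ => τ ^ (a - 1) * (τ + 1)⁻¹) (Ioi 0) := by
  have hm : ∀ s : Set ℝ, AEStronglyMeasurable (fun τ : ℝ => τ ^ (a - 1) * (τ + 1)⁻¹)
      (volume.restrict s) := fun s => by
    apply Measurable.aestronglyMeasurable
    fun_prop
  rw [← Ioc_union_Ioi_eq_Ioi zero_le_one]
  refine IntegrableOn.union ?_ ?_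
  · refine (integrableOn_rpow_Ioc (p := a - 1) (by linarith)).mono' (hm _) ?_
    refine (ae_restrict_iff' measurableSet_Ioc).2 (Eventually.of_forall fun τ hτ => ?_)
    have h2 : 0 < τ := hτ.1
    rw [Real.norm_of_nonneg (by positivity)]
    exact mul_le_of_le_one_right (by positivity) (inv_le_one_of_one_le₀ (by linarith))
  · refine (integrableOn_Ioi_rpow_of_lt (a := a - 2) (by linarith) one_pos).mono' (hm _) ?_
    refine (ae_restrict_iff' measurableSet_Ioi).2 (Eventually.of_forall fun τ hτ => ?_)
    have h2 : 0 < τ := one_pos.trans hτ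
    rw [Real.norm_of_nonneg (by positivity)]
    have : τ ^ (a - 2) = τ ^ (a - 1) * τ⁻¹ := by
      rw [← Real.rpow_neg_one, ← Real.rpow_add h2]; ring_nf
    rw [this]
    gcongr
    linarith

theorem integral_rpow_mul_inv_pos {a : ℝ} (h0 : 0 < a) (h1 : a < 1) :
    0 < ∫ τ in Ioi (0 : ℝ), τ ^ (a - 1) * (τ + 1)⁻¹ := by
  rw [setIntegral_pos_iff_support_of_nonneg_ae _ (integrableOn_rpow_mul_inv h0 h1)]
  · have : Ioi (0 : ℝ) ⊆ Function.support (fun τ : ℝ => τ ^ (a - 1) * (τ + 1)⁻¹) := by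
      intro τ hτ
      have : (0 : ℝ) < τ := hτ
      rw [Function.mem_support]
      positivity
    rw [inter_eq_right.2 this]
    simp
  · refine (ae_restrict_iff' measurableSet_Ioi).2 (Eventually.of_forall fun τ hτ => ?_)
    have : (0 : ℝ) < τ := hτ
    simp only [Pi.zero_apply]
    positivity

theorem rpow_mul_inv_sq_le {a τ : ℝ} (hτ : 0 < τ) :
    τ ^ a * ((τ + 1)⁻¹) ^ 2 ≤ τ ^ (a - 1) * (τ + 1)⁻¹ := by
  have : τ ^ a = τ ^ (a - 1) * τ := by
    rw [← Real.rpow_add_one hτ.ne']; ring_nf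
  rw [this, sq, mul_assoc]
  gcongr
  rw [← mul_assoc]
  refine mul_le_of_le_one_left (by positivity) ?_
  rw [← div_eq_mul_inv, div_le_one (by positivity)]
  linarith

theorem integrableOn_rpow_mul_inv_sq {a : ℝ} (h0 : 0 < a) (h1 : a < 1) :
    IntegrableOn (fun τ : ℝ => τ ^ a * ((τ + 1)⁻¹) ^ 2) (Ioi 0) := by
  refine (integrableOn_rpow_mul_inv h0 h1).mono'
    (Measurable.aestronglyMeasurable (by fun_prop)) ?_
  refine (ae_restrict_iff' measurableSet_Ioi).2 (Eventually.of_forall fun τ hτ => ?_)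
  have h2 : (0 : ℝ) < τ := hτ
  rw [Real.norm_of_nonneg (by positivity)]
  exact rpow_mul_inv_sq_le h2

/-- Integrate the derivative of τ^a (τ + 1)⁻¹, which vanishes at both ends because 0 < a < 1. The
factor a = s/2, doubled by the commutator, becomes the coefficient s in A(s). -/
theorem integral_rpow_mul_inv_sq {a : ℝ} (h0 : 0 < a) (h1 : a < 1) :
    ∫ τ in Ioi (0 : ℝ), τ ^ a * ((τ + 1)⁻¹) ^ 2 =
      a * ∫ τ in Ioi (0 : ℝ), τ ^ (a - 1) * (τ + 1)⁻¹ := by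
  have hi1 := integrableOn_rpow_mul_inv h0 h1
  have hi2 := integrableOn_rpow_mul_inv_sq h0 h1
  have hd : ∀ τ ∈ Ioi (0 : ℝ), HasDerivAt (fun τ : ℝ => τ ^ a * (τ + 1)⁻¹)
      (a * (τ ^ (a - 1) * (τ + 1)⁻¹) - τ ^ a * ((τ + 1)⁻¹) ^ 2) τ := by
    intro τ hτ
    have h2 : (0 : ℝ) < τ := hτ
    have e1 := Real.hasDerivAt_rpow_const (p := a) (Or.inl h2.ne')
    have e2 : HasDerivAt (fun τ : ℝ => (τ + 1)⁻¹) (-1 / (τ + 1) ^ 2) τ :=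
      ((hasDerivAt_id τ).add_const 1).inv (by positivity)
    refine (e1.mul e2).congr_deriv ?_
    field_simp
    ring
  have hc : ContinuousWithinAt (fun τ : ℝ => τ ^ a * (τ + 1)⁻¹) (Ici 0) 0 := by
    refine ContinuousAt.continuousWithinAt ?_
    refine ContinuousAt.mul (Real.continuousAt_rpow_const _ _ (Or.inr h0.le)) ?_
    exact ContinuousAt.inv₀ (by fun_prop) (by norm_num)
  have ht : Tendsto (fun τ : ℝ => τ ^ a * (τ + 1)⁻¹) atTop (𝓝 0) := by
    have hz := tendsto_rpow_neg_atTop (y := 1 - a) (by linarith)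
    refine squeeze_zero' ?_ ?_ hz
    · filter_upwards [eventually_gt_atTop (0 : ℝ)] with τ hτ
      positivity
    · filter_upwards [eventually_gt_atTop (0 : ℝ)] with τ hτ
      have : τ ^ (-(1 - a)) = τ ^ a * τ⁻¹ := by
        rw [← Real.rpow_neg_one, ← Real.rpow_add hτ]; ring_nf
      rw [this]
      gcongr
      linarith
  have key := integral_Ioi_of_hasDerivAt_of_tendsto hc hd ((hi1.const_mul a).sub hi2) ht
  rw [integral_sub (hi1.const_mul a) hi2, integral_const_mul, Real.zero_rpow h0.ne'] at key
  linarith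

/-- The spectral form of the integral representing a fractional power. -/
theorem integral_rpow_mul_symbol {a r : ℝ} (h0 : 0 < a) (h1 : a < 1) (hr : r ∈ Icc (0 : ℝ) 1) :
    ∫ τ in Ioi (0 : ℝ), τ ^ (a - 1) * (r / (τ * r + (1 - r)) * (1 - r)) =
      (∫ τ in Ioi (0 : ℝ), τ ^ (a - 1) * (τ + 1)⁻¹) * ((1 - r) ^ a * r ^ (1 - a)) := by
  -- At r = 0 and r = 1 the spectral value λ = (1 - r)/r of H is infinite or zero and cannot be
  -- scaled out, but both sides vanish. Otherwise substitute τ = λu.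
  rcases hr.1.eq_or_lt with rfl | hr0
  · simp [Real.zero_rpow (sub_pos.2 h1).ne']
  rcases hr.2.eq_or_lt with rfl | hr1
  · simp [Real.zero_rpow h0.ne']
  have hr1' : 0 < 1 - r := sub_pos.2 hr1
  have hl : 0 < (1 - r) / r := by positivity
  have hsub := integral_comp_mul_left_Ioi
    (fun τ : ℝ => τ ^ (a - 1) * (r / (τ * r + (1 - r)) * (1 - r))) 0 hl
  rw [mul_zero, smul_eq_mul] at hsub
  have hcongr : ∫ u in Ioi (0 : ℝ), ((1 - r) / r * u) ^ (a - 1) *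
      (r / ((1 - r) / r * u * r + (1 - r)) * (1 - r)) =
      ∫ u in Ioi (0 : ℝ), (((1 - r) / r) ^ (a - 1) * r) * (u ^ (a - 1) * (u + 1)⁻¹) := by
    refine setIntegral_congr_fun measurableSet_Ioi fun u hu => ?_
    have h2 : (0 : ℝ) < u := hu
    rw [Real.mul_rpow hl.le h2.le]
    field_simp
  rw [hcongr, integral_const_mul, eq_inv_mul_iff_mul_eq₀ hl.ne'] at hsub
  rw [← hsub]
  have e : (1 - r) / r * (((1 - r) / r) ^ (a - 1) * r) = (1 - r) ^ a * r ^ (1 - a) := by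
    rw [← mul_assoc, mul_comm ((1 - r) / r), ← Real.rpow_add_one hl.ne', sub_add_cancel,
      Real.div_rpow hr1'.le hr0.le, Real.rpow_sub hr0, Real.rpow_one]
    field_simp
  rw [← e]
  ring

theorem integral_rpow_mul_symbol_sq {a r : ℝ} (h0 : 0 < a) (h1 : a < 1) (hr : r ∈ Icc (0 : ℝ) 1) :
    ∫ τ in Ioi (0 : ℝ), τ ^ a * ((r / (τ * r + (1 - r))) ^ 2 * (1 - r)) =
      a * (∫ τ in Ioi (0 : ℝ), τ ^ (a - 1) * (τ + 1)⁻¹) * ((1 - r) ^ a * r ^ (1 - a)) := by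
  rcases hr.1.eq_or_lt with rfl | hr0
  · simp [Real.zero_rpow (sub_pos.2 h1).ne']
  rcases hr.2.eq_or_lt with rfl | hr1
  · simp [Real.zero_rpow h0.ne']
  have hr1' : 0 < 1 - r := sub_pos.2 hr1
  have hl : 0 < (1 - r) / r := by positivity
  have hsub := integral_comp_mul_left_Ioi
    (fun τ : ℝ => τ ^ a * ((r / (τ * r + (1 - r))) ^ 2 * (1 - r))) 0 hl
  rw [mul_zero, smul_eq_mul] at hsub
  have hcongr : ∫ u in Ioi (0 : ℝ), ((1 - r) / r * u) ^ a *
      ((r / ((1 - r) / r * u * r + (1 - r))) ^ 2 * (1 - r)) =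
      ∫ u in Ioi (0 : ℝ), (((1 - r) / r) ^ a * (r ^ 2 / (1 - r))) *
        (u ^ a * ((u + 1)⁻¹) ^ 2) := by
    refine setIntegral_congr_fun measurableSet_Ioi fun u hu => ?_
    have h2 : (0 : ℝ) < u := hu
    rw [Real.mul_rpow hl.le h2.le]
    field_simp
  rw [hcongr, integral_const_mul, eq_inv_mul_iff_mul_eq₀ hl.ne', integral_rpow_mul_inv_sq h0 h1]
    at hsub
  rw [← hsub]
  have e : (1 - r) / r * (((1 - r) / r) ^ a * (r ^ 2 / (1 - r))) = (1 - r) ^ a * r ^ (1 - a) := by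
    rw [Real.div_rpow hr1'.le hr0.le, Real.rpow_sub hr0, Real.rpow_one]
    field_simp
  rw [← e]
  ring

theorem symbol_denom_pos {τ r : ℝ} (hτ : 0 < τ) (hr : r ∈ Icc (0 : ℝ) 1) :
    0 < τ * r + (1 - r) := by
  rcases hr.1.eq_or_lt with rfl | h
  · norm_num
  · have := mul_pos hτ h
    linarith [hr.2]

/-- After clearing denominators the difference of the two sides is τ r² + (1 - r)². The bound is
uniform in r, which is what dominated convergence under the functional calculus requires. -/
theorem symbol_le {τ r : ℝ} (hτ : 0 < τ) (hr : r ∈ Icc (0 : ℝ) 1) :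
    r / (τ * r + (1 - r)) * (1 - r) ≤ (τ + 1)⁻¹ := by
  have hd := symbol_denom_pos hτ hr
  have h0 := hr.1
  have h1 := hr.2
  rw [div_mul_eq_mul_div, ← one_div, div_le_div_iff₀ hd (by positivity)]
  nlinarith [mul_nonneg h0 hτ.le, mul_nonneg (mul_nonneg h0 h0) hτ.le, sq_nonneg (1 - r)]

theorem continuousOn_symbol {p : ℝ} {k : ℕ} :
    ContinuousOn (Function.uncurry
      fun τ r : ℝ => τ ^ p * ((r / (τ * r + (1 - r))) ^ k * (1 - r))) (Ioi 0 ×ˢ Icc 0 1) := by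
  rintro ⟨τ, r⟩ ⟨hτ, hr⟩
  have hd := symbol_denom_pos hτ hr
  have h2 : (0 : ℝ) < τ := hτ
  refine ContinuousAt.continuousWithinAt ?_
  refine ContinuousAt.mul (ContinuousAt.rpow_const continuousAt_fst (Or.inl h2.ne')) ?_
  refine ContinuousAt.mul (ContinuousAt.pow (f := fun q : ℝ × ℝ => q.2 / (q.1 * q.2 + (1 - q.2)))
    (ContinuousAt.div (by fun_prop) (by fun_prop) hd.ne') _) (by fun_prop)

end Scalar

/-! ### Fractional powers -/

section Abstract

variable {𝓗 : Type*} [NormedAddCommGroup 𝓗] [InnerProductSpace ℂ 𝓗] [CompleteSpace 𝓗]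
  {H : 𝓗 →ₗ.[ℂ] 𝓗}

/-- The bounded operator `H ^ a (1 + H)⁻¹`. -/
def fracKernel (H : 𝓗 →ₗ.[ℂ] 𝓗) (a : ℝ) : 𝓗 →L[ℂ] 𝓗 :=
  cfc (fun r : ℝ => (1 - r) ^ a * r ^ (1 - a)) (resolventOp H 1)

namespace IsNonnegSelfAdjoint

theorem cfc_rpow_mul (hH : IsNonnegSelfAdjoint H) {a : ℝ} (h0 : 0 < a) (h1 : a < 1) :
    cfc (fun r : ℝ => r ^ a) (resolventOp H 1) * cfc (fun r : ℝ => r ^ (1 - a)) (resolventOp H 1) =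
      resolventOp H 1 := by
  have hsa := hH.isSelfAdjoint_res one_pos
  rw [← cfc_mul _ _ _ (Real.continuous_rpow_const h0.le).continuousOn
    (Real.continuous_rpow_const (sub_pos.2 h1).le).continuousOn]
  conv_rhs => rw [← cfc_id' ℝ (resolventOp H 1)]
  refine cfc_congr fun r hr => ?_
  have h := (hH.spectrum_res_one hr).1
  rw [← Real.rpow_add_of_nonneg h h0.le (sub_pos.2 h1).le, add_sub_cancel, Real.rpow_one]

theorem cfc_commute (f g : ℝ → ℝ) (R : 𝓗 →L[ℂ] 𝓗) (x : 𝓗) :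
    cfc f R (cfc g R x) = cfc g R (cfc f R x) := by
  have := (cfc_commute_cfc f g R).eq
  exact congrArg (fun T : 𝓗 →L[ℂ] 𝓗 => T x) this

theorem inner_cfc (f : ℝ → ℝ) (R : 𝓗 →L[ℂ] 𝓗) (x y : 𝓗) :
    inner ℂ (cfc f R x) y = inner ℂ x (cfc f R y) :=
  ContinuousLinearMap.isSelfAdjoint_iff_isSymmetric.1
    (cfc_predicate f R : IsSelfAdjoint (cfc f R)) x y

/-- The range in `fracPow` really is a graph: if R^a g = 0 then R g = R^(1-a) R^a g = 0, so g = 0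
because R is injective. -/
theorem mem_graph_fracPow (hH : IsNonnegSelfAdjoint H) {a : ℝ} (h0 : 0 < a) (h1 : a < 1) (f h : 𝓗) :
    (f, h) ∈ (fracPow H a).graph ↔ ∃ g, cfc (fun r : ℝ => r ^ a) (resolventOp H 1) g = f ∧
      cfc (fun r : ℝ => (1 - r) ^ a) (resolventOp H 1) g = h := by
  unfold fracPow
  rw [Submodule.toLinearPMap_graph_eq]
  · simp only [LinearMap.mem_range, LinearMap.prod_apply, Function.prod_apply, Prod.mk.injEq,
      ContinuousLinearMap.coe_coe]
  · rintro ⟨x, y⟩ ⟨g, hg⟩ hx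
    simp only [LinearMap.prod_apply, Function.prod_apply, Prod.mk.injEq,
      ContinuousLinearMap.coe_coe] at hg hx
    have hz : resolventOp H 1 g = 0 := by
      rw [← hH.cfc_rpow_mul h0 h1]
      rw [mul_apply_eq_comp]
      rw [cfc_commute, hg.1, hx, map_zero]
    have : g = 0 := hH.res_injective one_pos hz
    rw [← hg.2, this, map_zero]

/-- R^a and (1 - R)^a are self-adjoint and commute, being functions of the same R. -/
theorem fracPow_symm (hH : IsNonnegSelfAdjoint H) {a : ℝ} (h0 : 0 < a) (h1 : a < 1) {f h f' h' : 𝓗}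
    (hf : (f, h) ∈ (fracPow H a).graph) (hf' : (f', h') ∈ (fracPow H a).graph) :
    inner ℂ h f' = inner ℂ f h' := by
  obtain ⟨g, rfl, rfl⟩ := (hH.mem_graph_fracPow h0 h1 _ _).1 hf
  obtain ⟨g', rfl, rfl⟩ := (hH.mem_graph_fracPow h0 h1 _ _).1 hf'
  rw [inner_cfc, inner_cfc, cfc_commute]

/-- Since f = R (f + h) = R^a (R^(1-a) (f + h)), the vector R^(1-a) (f + h) is the required
preimage. On D(H) the fractional power is thus given by a bounded operator applied to f + h. -/
theorem mem_graph_fracPow_of_mem_graph (hH : IsNonnegSelfAdjoint H) {a : ℝ} (h0 : 0 < a)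
    (h1 : a < 1) {f h : 𝓗} (hf : (f, h) ∈ H.graph) :
    (f, fracKernel H a (f + h)) ∈ (fracPow H a).graph := by
  rw [hH.mem_graph_fracPow h0 h1]
  have hsa := hH.isSelfAdjoint_res one_pos
  refine ⟨cfc (fun r : ℝ => r ^ (1 - a)) (resolventOp H 1) (f + h), ?_, ?_⟩
  · change (cfc (fun r : ℝ => r ^ a) (resolventOp H 1) *
      cfc (fun r : ℝ => r ^ (1 - a)) (resolventOp H 1)) (f + h) = f
    rw [hH.cfc_rpow_mul h0 h1]
    simpa using hH.res_shift one_pos hf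
  · unfold fracKernel
    rw [cfc_mul (fun r : ℝ => (1 - r) ^ a) (fun r : ℝ => r ^ (1 - a)) _
      ((Real.continuous_rpow_const h0.le).comp (continuous_const.sub continuous_id)).continuousOn
      (Real.continuous_rpow_const (sub_pos.2 h1).le).continuousOn]
    rfl

/-- The operator τ R_1 + (1 - R_1) equals (τ + H) R_1, so R_τ sends it to R_1; its symbol is
positive on [0, 1], so it can be inverted in the functional calculus. -/
theorem res_eq_cfc (hH : IsNonnegSelfAdjoint H) {τ : ℝ} (hτ : 0 < τ) :
    resolventOp H τ = cfc (fun r : ℝ => r / (τ * r + (1 - r))) (resolventOp H 1) := by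
  have hsa := hH.isSelfAdjoint_res one_pos
  set R := resolventOp H 1 with hR
  have hcd : ContinuousOn (fun r : ℝ => τ * r + (1 - r)) (spectrum ℝ R) := by fun_prop
  have hci : ContinuousOn (fun r : ℝ => (τ * r + (1 - r))⁻¹) (spectrum ℝ R) :=
    hcd.inv₀ fun r hr => (symbol_denom_pos hτ (hH.spectrum_res_one hr)).ne'
  have e1 : cfc (fun r : ℝ => τ * r + (1 - r)) R = τ • R + (1 - R) := by
    rw [cfc_add .., cfc_sub .., cfc_const_mul .., cfc_id' .., cfc_const_one ..]
  have e2 : resolventOp H τ * cfc (fun r : ℝ => τ * r + (1 - r)) R = R := by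
    rw [e1]
    ext g
    have := hH.res_shift hτ (hH.res_mem_graph one_pos g)
    rw [Complex.ofReal_one, one_smul] at this
    exact this
  have e3 : cfc (fun r : ℝ => τ * r + (1 - r)) R * cfc
      (fun r : ℝ => (τ * r + (1 - r))⁻¹) R = 1 := by
    rw [← cfc_mul _ _ _ hcd hci, ← cfc_const_one ℝ R]
    exact cfc_congr fun r hr => mul_inv_cancel₀ (symbol_denom_pos hτ (hH.spectrum_res_one hr)).ne'
  calc resolventOp H τ = resolventOp H τ * (cfc (fun r : ℝ => τ * r + (1 - r)) R *
        cfc (fun r : ℝ => (τ * r + (1 - r))⁻¹) R) := by rw [e3, mul_one]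
    _ = R * cfc (fun r : ℝ => (τ * r + (1 - r))⁻¹) R := by rw [← mul_assoc, e2]
    _ = _ := by
      conv_lhs => rw [← cfc_id' ℝ R]
      rw [cfc_id' ℝ R]
      nth_rewrite 1 [← cfc_id' ℝ R]
      rw [← cfc_mul _ _ _ (by fun_prop) hci]
      rfl

theorem cfc_symbol (hH : IsNonnegSelfAdjoint H) {τ p : ℝ} (hτ : 0 < τ) (k : ℕ) :
    cfc (fun r : ℝ => τ ^ p * ((r / (τ * r + (1 - r))) ^ k * (1 - r))) (resolventOp H 1) =
      τ ^ p • (resolventOp H τ ^ k * (1 - resolventOp H 1)) := by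
  have hsa := hH.isSelfAdjoint_res one_pos
  have hc : ContinuousOn (fun r : ℝ => r / (τ * r + (1 - r))) (spectrum ℝ (resolventOp H 1)) :=
    ContinuousOn.div (by fun_prop) (by fun_prop)
      fun r hr => (symbol_denom_pos hτ (hH.spectrum_res_one hr)).ne'
  rw [cfc_const_mul (τ ^ p) (fun r : ℝ => (r / (τ * r + (1 - r))) ^ k * (1 - r)) _
      ((hc.pow k).mul (by fun_prop)),
    cfc_mul (fun r : ℝ => (r / (τ * r + (1 - r))) ^ k) _ _ (hc.pow k) (by fun_prop),
    cfc_pow _ _ _ hc, ← hH.res_eq_cfc hτ, cfc_sub .., cfc_id' .., cfc_const_one ..]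

/-- The common core of the two integral formulas (k = 1 and k = 2): the τ-integral is moved inside
the functional calculus of R_1. The factor 1 - R_1 makes this possible in norm, since it compensates
the growth of R_τ as τ → 0. -/
theorem integrableOn_and_integral_symbol (hH : IsNonnegSelfAdjoint H) {a p m : ℝ} (h0 : 0 < a)
    (h1 : a < 1) (k : ℕ)
    (hle : ∀ τ : ℝ, 0 < τ → ∀ r ∈ Icc (0 : ℝ) 1,
      τ ^ p * ((r / (τ * r + (1 - r))) ^ k * (1 - r)) ≤ τ ^ (a - 1) * (τ + 1)⁻¹)
    (hint : ∀ r ∈ Icc (0 : ℝ) 1, ∫ τ in Ioi (0 : ℝ), τ ^ p * ((r / (τ * r + (1 - r))) ^ k * (1 - r)) =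
      m * ((1 - r) ^ a * r ^ (1 - a))) :
    IntegrableOn (fun τ : ℝ => τ ^ p • (resolventOp H τ ^ k * (1 - resolventOp H 1))) (Ioi 0) ∧
    ∫ τ in Ioi (0 : ℝ), τ ^ p • (resolventOp H τ ^ k * (1 - resolventOp H 1)) =
      m • fracKernel H a := by
  have hsa := hH.isSelfAdjoint_res one_pos
  have hcont : ContinuousOn (Function.uncurry
      fun τ r : ℝ => τ ^ p * ((r / (τ * r + (1 - r))) ^ k * (1 - r)))
      (Ioi 0 ×ˢ spectrum ℝ (resolventOp H 1)) :=
    continuousOn_symbol.mono (prod_mono_right hH.spectrum_res_one)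
  have hb : ∀ᵐ τ ∂(volume.restrict (Ioi (0 : ℝ))), ∀ r ∈ spectrum ℝ (resolventOp H 1),
      ‖τ ^ p * ((r / (τ * r + (1 - r))) ^ k * (1 - r))‖ ≤ τ ^ (a - 1) * (τ + 1)⁻¹ := by
    refine (ae_restrict_iff' measurableSet_Ioi).2 (Eventually.of_forall fun τ hτ r hr => ?_)
    have h2 : (0 : ℝ) < τ := hτ
    have hr' := hH.spectrum_res_one hr
    have hd := symbol_denom_pos h2 hr'
    have hr0 := hr'.1
    have hr1 := sub_nonneg.2 hr'.2
    rw [Real.norm_of_nonneg (by positivity)]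
    exact hle τ h2 r hr'
  have hfi := (integrableOn_rpow_mul_inv h0 h1).2
  have hI := integrableOn_cfc measurableSet_Ioi _ _ (resolventOp H 1) hcont hb hfi hsa
  have hE := cfc_setIntegral measurableSet_Ioi _ _ (resolventOp H 1) hcont hb hfi hsa
  refine ⟨hI.congr_fun (fun τ hτ => hH.cfc_symbol hτ k) measurableSet_Ioi, ?_⟩
  rw [← setIntegral_congr_fun measurableSet_Ioi (fun τ hτ => hH.cfc_symbol hτ k), ← hE]
  unfold fracKernel
  rw [← cfc_const_mul m (fun r : ℝ => (1 - r) ^ a * r ^ (1 - a)) _ (ContinuousOn.mul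
    ((Real.continuous_rpow_const h0.le).comp (continuous_const.sub continuous_id)).continuousOn
    (Real.continuous_rpow_const (sub_pos.2 h1).le).continuousOn)]
  exact cfc_congr fun r hr => hint r (hH.spectrum_res_one hr)

/-- Balakrishnan's formula on D(H): apply the operator identity with k = 1 to f + h, where (1 -
R_1)(f + h) = h. -/
theorem integrableOn_and_integral_res (hH : IsNonnegSelfAdjoint H) {a : ℝ} (h0 : 0 < a)
    (h1 : a < 1) {f h : 𝓗} (hf : (f, h) ∈ H.graph) :
    IntegrableOn (fun τ : ℝ => ((τ ^ (a - 1) : ℝ) : ℂ) • resolventOp H τ h) (Ioi 0) ∧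
    ∫ τ in Ioi (0 : ℝ), ((τ ^ (a - 1) : ℝ) : ℂ) • resolventOp H τ h =
      ((∫ τ in Ioi (0 : ℝ), τ ^ (a - 1) * (τ + 1)⁻¹ : ℝ) : ℂ) • fracKernel H a (f + h) := by
  obtain ⟨hI, hE⟩ := hH.integrableOn_and_integral_symbol (p := a - 1) h0 h1 1
    (fun τ hτ r hr => by
      rw [pow_one]
      have := symbol_le hτ hr
      gcongr)
    (fun r hr => by simp only [pow_one]; exact integral_rpow_mul_symbol h0 h1 hr)
  have e : ∀ τ : ℝ, (τ ^ (a - 1) • (resolventOp H τ ^ 1 * (1 - resolventOp H 1)) : 𝓗 →L[ℂ] 𝓗)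
      (f + h) =
      ((τ ^ (a - 1) : ℝ) : ℂ) • resolventOp H τ h := by
    intro τ
    rw [pow_one]
    change τ ^ (a - 1) • resolventOp H τ ((1 - resolventOp H 1) (f + h)) = _
    rw [hH.one_sub_res_shift hf]
    rfl
  refine ⟨(hI.apply_continuousLinearMap (f + h)).congr (Eventually.of_forall e), ?_⟩
  simp_rw [← e]
  rw [← ContinuousLinearMap.integral_apply hI, hE]
  rfl

/-- The companion formula for the term R_τ H R_τ of the resolvent commutator. Domination reduces to
the case k = 1 because the extra factor τ R_τ has symbol at most 1. -/
theorem integrableOn_and_integral_res_sq (hH : IsNonnegSelfAdjoint H) {a : ℝ} (h0 : 0 < a)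
    (h1 : a < 1) {f h : 𝓗} (hf : (f, h) ∈ H.graph) :
    IntegrableOn (fun τ : ℝ => ((τ ^ a : ℝ) : ℂ) • resolventOp H τ (resolventOp H τ h)) (Ioi 0) ∧
    ∫ τ in Ioi (0 : ℝ), ((τ ^ a : ℝ) : ℂ) • resolventOp H τ (resolventOp H τ h) =
      ((a * ∫ τ in Ioi (0 : ℝ), τ ^ (a - 1) * (τ + 1)⁻¹ : ℝ) : ℂ) • fracKernel H a (f + h) := by
  obtain ⟨hI, hE⟩ := hH.integrableOn_and_integral_symbol (p := a) h0 h1 2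
    (fun τ hτ r hr => by
      have := symbol_le hτ hr
      have hd := symbol_denom_pos hτ hr
      have hr0 := hr.1
      have hr1 := sub_nonneg.2 hr.2
      have e : τ ^ a = τ ^ (a - 1) * τ := by
        rw [← Real.rpow_add_one hτ.ne']; ring_nf
      rw [e, mul_assoc]
      gcongr
      have h3 : τ * (r / (τ * r + (1 - r))) ≤ 1 := by
        rw [← mul_div_assoc, div_le_one hd]; linarith
      calc τ * ((r / (τ * r + (1 - r))) ^ 2 * (1 - r))
          = (τ * (r / (τ * r + (1 - r)))) * (r / (τ * r + (1 - r)) * (1 - r)) := by ring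
        _ ≤ 1 * (τ + 1)⁻¹ := by gcongr
        _ = _ := one_mul _)
    (fun r hr => integral_rpow_mul_symbol_sq h0 h1 hr)
  have e : ∀ τ : ℝ, (τ ^ a • (resolventOp H τ ^ 2 * (1 - resolventOp H 1)) : 𝓗 →L[ℂ] 𝓗) (f + h) =
      ((τ ^ a : ℝ) : ℂ) • resolventOp H τ (resolventOp H τ h) := by
    intro τ
    rw [pow_two]
    change τ ^ a • resolventOp H τ (resolventOp H τ ((1 - resolventOp H 1) (f + h))) = _
    rw [hH.one_sub_res_shift hf]
    rfl
  refine ⟨(hI.apply_continuousLinearMap (f + h)).congr (Eventually.of_forall e), ?_⟩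
  simp_rw [← e]
  rw [← ContinuousLinearMap.integral_apply hI, hE]
  rfl

end IsNonnegSelfAdjoint

end Abstract

end Schrodinger2D

end

noncomputable section

namespace Schrodinger2D

open Filter Topology

/-! ### Schwartz functions as test functions -/

section Schwartz

/-- Schwartz functions as elements of `L²`. -/
def toL2 : 𝓢(Plane, ℂ) →L[ℂ] L2 := SchwartzMap.toLpCLM ℂ ℂ 2 volume

theorem toL2_eq (φ : 𝓢(Plane, ℂ)) : toL2 φ = φ.toLp 2 volume := rfl

theorem coeFn_toL2 (φ : 𝓢(Plane, ℂ)) : toL2 φ =ᵐ[volume] φ := φ.coeFn_toLp 2 volume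

theorem denseRange_toL2 : DenseRange toL2 :=
  SchwartzMap.denseRange_toLpCLM (by norm_num)

/-- Complex conjugation of Schwartz functions. -/
def conjS (φ : 𝓢(Plane, ℂ)) : 𝓢(Plane, ℂ) :=
  SchwartzMap.postcompCLM (𝕜 := ℝ) (Complex.conjCLE : ℂ →L[ℝ] ℂ) φ

@[simp] theorem conjS_apply (φ : 𝓢(Plane, ℂ)) (x : Plane) :
    conjS φ x = (starRingEnd ℂ) (φ x) := rfl

@[simp] theorem conjS_conjS (φ : 𝓢(Plane, ℂ)) : conjS (conjS φ) = φ := by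
  ext x; simp

/-- The unit vectors of the plane. -/
abbrev unitVec (i : Fin 2) : Plane := EuclideanSpace.single i (1 : ℝ)

theorem conjS_lineDeriv (φ : 𝓢(Plane, ℂ)) (m : Plane) : ∂_{m} (conjS φ) = conjS (∂_{m} φ) := by
  ext x
  rw [conjS_apply, SchwartzMap.lineDerivOp_apply_eq_fderiv, SchwartzMap.lineDerivOp_apply_eq_fderiv]
  have := (Complex.conjCLE : ℂ →L[ℝ] ℂ).hasFDerivAt.comp x (φ.hasFDerivAt x)
  have h2 : HasFDerivAt (conjS φ) ((Complex.conjCLE : ℂ →L[ℝ] ℂ) ∘L fderiv ℝ φ x) x := this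
  rw [h2.fderiv]
  rfl

theorem laplacian_eq (φ : 𝓢(Plane, ℂ)) :
    Δ φ = ∑ i, ∂_{unitVec i} (∂_{unitVec i} φ) := by
  rw [SchwartzMap.laplacian_eq_sum (EuclideanSpace.basisFun (Fin 2) ℝ)]
  simp

theorem conjS_sum (f : Fin 2 → 𝓢(Plane, ℂ)) : conjS (∑ i, f i) = ∑ i, conjS (f i) := by
  ext x; simp

theorem conjS_laplacian (φ : 𝓢(Plane, ℂ)) : Δ (conjS φ) = conjS (Δ φ) := by
  simp only [laplacian_eq, conjS_sum, conjS_lineDeriv]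

theorem coord_hasTemperateGrowth (i : Fin 2) :
    Function.HasTemperateGrowth (fun x : Plane => ((x i : ℝ) : ℂ)) :=
  (Complex.ofRealCLM ∘L (EuclideanSpace.proj i : Plane →L[ℝ] ℝ)).hasTemperateGrowth

/-- Multiplication of a Schwartz function by a coordinate. -/
def coordMul (i : Fin 2) : 𝓢(Plane, ℂ) →L[ℂ] 𝓢(Plane, ℂ) :=
  SchwartzMap.smulLeftCLM ℂ (fun x : Plane => ((x i : ℝ) : ℂ))

@[simp] theorem coordMul_apply (i : Fin 2) (φ : 𝓢(Plane, ℂ)) (x : Plane) :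
    coordMul i φ x = ((x i : ℝ) : ℂ) * φ x := by
  unfold coordMul
  rw [SchwartzMap.smulLeftCLM_apply_apply (coord_hasTemperateGrowth i), smul_eq_mul]

theorem lineDeriv_coordMul (i : Fin 2) (φ : 𝓢(Plane, ℂ)) :
    ∂_{unitVec i} (coordMul i φ) = φ + coordMul i (∂_{unitVec i} φ) := by
  ext x
  rw [add_apply, coordMul_apply, SchwartzMap.lineDerivOp_apply_eq_fderiv,
    SchwartzMap.lineDerivOp_apply_eq_fderiv]
  have h1 : HasFDerivAt (fun x : Plane => ((x i : ℝ) : ℂ))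
      (Complex.ofRealCLM ∘L (EuclideanSpace.proj i : Plane →L[ℝ] ℝ)) x :=
    (Complex.ofRealCLM ∘L (EuclideanSpace.proj i : Plane →L[ℝ] ℝ)).hasFDerivAt
  have h2 := h1.mul (φ.hasFDerivAt x)
  have h3 : HasFDerivAt (coordMul i φ) _ x :=
    h2.congr_of_eventuallyEq (Eventually.of_forall fun y => coordMul_apply i φ y)
  rw [h3.fderiv]
  simp
  ring

/-- The operator `x · ∇` on Schwartz functions. -/
def xDG : 𝓢(Plane, ℂ) →ₗ[ℂ] 𝓢(Plane, ℂ) :=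
  ∑ i : Fin 2, (coordMul i).toLinearMap ∘ₗ
    (LineDeriv.lineDerivOpCLM ℂ 𝓢(Plane, ℂ) (unitVec i)).toLinearMap

theorem xDG_eq (φ : 𝓢(Plane, ℂ)) : xDG φ = ∑ i, coordMul i (∂_{unitVec i} φ) := by
  simp [xDG]

theorem xDG_apply (φ : 𝓢(Plane, ℂ)) (x : Plane) : xDG φ x = fderiv ℝ φ x x := by
  rw [xDG_eq]
  have hx := congrArg (fderiv ℝ φ x) ((EuclideanSpace.basisFun (Fin 2) ℝ).sum_repr x)
  rw [map_sum] at hx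
  rw [← hx]
  simp [SchwartzMap.lineDerivOp_apply_eq_fderiv]

/-- The 2 is the dimension, the divergence of the field x; it is also the 2 in D* = -D - 2. -/
theorem sum_lineDeriv_coordMul (φ : 𝓢(Plane, ℂ)) :
    ∑ i, ∂_{unitVec i} (coordMul i φ) = xDG φ + (2 : ℂ) • φ := by
  simp only [lineDeriv_coordMul, Finset.sum_add_distrib, xDG_eq, Finset.sum_const, Finset.card_univ,
    Fintype.card_fin]
  rw [add_comm]
  congr 1
  ext x; simp

theorem conjS_coordMul (i : Fin 2) (φ : 𝓢(Plane, ℂ)) :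
    coordMul i (conjS φ) = conjS (coordMul i φ) := by
  ext x; simp

theorem conjS_xDG (φ : 𝓢(Plane, ℂ)) : xDG (conjS φ) = conjS (xDG φ) := by
  simp only [xDG_eq, conjS_sum, conjS_lineDeriv, conjS_coordMul]

/-- The distributional pairing is bilinear whereas the inner product conjugates its first slot.
Conjugating the test function reconciles them, so that graph membership becomes a family of closed
inner-product conditions. -/
theorem distr_apply_conjS (f : L2) (ψ : 𝓢(Plane, ℂ)) :
    Lp.toTemperedDistributionCLM ℂ volume 2 f (conjS ψ) = inner ℂ (toL2 ψ) f := by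
  rw [Lp.toTemperedDistributionCLM_apply, Lp.toTemperedDistribution_apply, L2.inner_def]
  refine integral_congr_ae ?_
  filter_upwards [coeFn_toL2 ψ] with x hx
  rw [hx, RCLike.inner_apply, conjS_apply, smul_eq_mul, mul_comm]

theorem distr_apply (f : L2) (ψ : 𝓢(Plane, ℂ)) :
    Lp.toTemperedDistributionCLM ℂ volume 2 f ψ = inner ℂ (toL2 (conjS ψ)) f := by
  rw [← distr_apply_conjS, conjS_conjS]

theorem mem_graph_laplacian (f g : L2) :
    (f, g) ∈ laplacianL2.graph ↔
      ∀ ψ : 𝓢(Plane, ℂ), inner ℂ (toL2 (Δ ψ)) f = inner ℂ (toL2 ψ) g := by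
  unfold laplacianL2
  rw [mem_graph_l2Realization]
  constructor
  · intro h ψ
    have h1 := congrArg (fun T : 𝓢'(Plane, ℂ) => T (conjS ψ)) h
    rw [TemperedDistribution.laplacianCLM_apply] at h1
    rw [TemperedDistribution.laplacian_apply_apply, conjS_laplacian, distr_apply_conjS,
      distr_apply_conjS] at h1
    exact h1
  · intro h
    ext ψ
    rw [TemperedDistribution.laplacianCLM_apply, TemperedDistribution.laplacian_apply_apply,
      distr_apply, distr_apply, ← conjS_laplacian, h]

theorem xDotGradDistr_apply (T : 𝓢'(Plane, ℂ)) (ψ : 𝓢(Plane, ℂ)) :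
    xDotGradDistr T ψ = T (-(xDG ψ) - (2 : ℂ) • ψ) := by
  rw [← neg_add', ← sum_lineDeriv_coordMul, map_neg, map_sum, ← Finset.sum_neg_distrib]
  unfold xDotGradDistr
  simp [coordMul, TemperedDistribution.lineDerivOp_apply_apply]
  exact add_comm _ _

/-- The formal adjoint `-(x · ∇) - 2` of `x · ∇` on Schwartz functions. -/
def xDGadj (ψ : 𝓢(Plane, ℂ)) : 𝓢(Plane, ℂ) := -(xDG ψ) - (2 : ℂ) • ψ

theorem conjS_xDGadj (ψ : 𝓢(Plane, ℂ)) : xDGadj (conjS ψ) = conjS (xDGadj ψ) := by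
  unfold xDGadj
  rw [conjS_xDG]
  ext x
  simp [Complex.conj_ofNat]

theorem mem_graph_xDotGrad (f g : L2) :
    (f, g) ∈ xDotGrad.graph ↔
      ∀ ψ : 𝓢(Plane, ℂ), inner ℂ (toL2 (xDGadj ψ)) f = inner ℂ (toL2 ψ) g := by
  unfold xDotGrad
  rw [mem_graph_l2Realization]
  constructor
  · intro h ψ
    have h1 := congrArg (fun T : 𝓢'(Plane, ℂ) => T (conjS ψ)) h
    rw [xDotGradDistr_apply] at h1
    change _ = Lp.toTemperedDistributionCLM ℂ volume 2 g (conjS ψ) at h1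
    rw [← xDGadj, conjS_xDGadj, distr_apply_conjS, distr_apply_conjS] at h1
    exact h1
  · intro h
    ext ψ
    rw [xDotGradDistr_apply, distr_apply, distr_apply, ← xDGadj, ← conjS_xDGadj, h]

theorem inner_toL2 (φ ψ : 𝓢(Plane, ℂ)) :
    inner ℂ (toL2 φ) (toL2 ψ) = ∫ x, conjS φ x * ψ x := by
  rw [toL2_eq, toL2_eq, SchwartzMap.inner_toL2_toL2_eq φ ψ volume]
  simp only [RCLike.inner_apply, conjS_apply, mul_comm]

theorem inner_lineDeriv (φ ψ : 𝓢(Plane, ℂ)) (m : Plane) :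
    inner ℂ (toL2 φ) (toL2 (∂_{m} ψ)) = -inner ℂ (toL2 (∂_{m} φ)) (toL2 ψ) := by
  rw [inner_toL2, inner_toL2, SchwartzMap.integral_mul_lineDerivOp_right_eq_neg_left,
    conjS_lineDeriv]

theorem inner_coordMul (φ ψ : 𝓢(Plane, ℂ)) (i : Fin 2) :
    inner ℂ (toL2 φ) (toL2 (coordMul i ψ)) = inner ℂ (toL2 (coordMul i φ)) (toL2 ψ) := by
  rw [inner_toL2, inner_toL2]
  congr 1
  ext x
  simp
  ring

theorem inner_laplacian (φ ψ : 𝓢(Plane, ℂ)) :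
    inner ℂ (toL2 φ) (toL2 (Δ ψ)) = -∑ i, inner ℂ (toL2 (∂_{unitVec i} φ))
      (toL2 (∂_{unitVec i} ψ)) := by
  rw [laplacian_eq, map_sum, inner_sum, ← Finset.sum_neg_distrib]
  simp only [inner_lineDeriv]

theorem inner_laplacian_comm (φ ψ : 𝓢(Plane, ℂ)) :
    inner ℂ (toL2 (Δ φ)) (toL2 ψ) = inner ℂ (toL2 φ) (toL2 (Δ ψ)) := by
  rw [← inner_conj_symm, inner_laplacian, inner_laplacian, map_neg, map_sum]
  simp only [inner_conj_symm]

theorem toL2_mem_graph_laplacian (φ : 𝓢(Plane, ℂ)) :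
    (toL2 φ, toL2 (Δ φ)) ∈ laplacianL2.graph :=
  (mem_graph_laplacian _ _).2 fun ψ => inner_laplacian_comm ψ φ

theorem inner_xDGadj (φ ψ : 𝓢(Plane, ℂ)) :
    inner ℂ (toL2 (xDGadj ψ)) (toL2 φ) = inner ℂ (toL2 ψ) (toL2 (xDG φ)) := by
  rw [xDG_eq, map_sum, inner_sum]
  simp only [inner_coordMul, inner_lineDeriv]
  rw [Finset.sum_neg_distrib, ← sum_inner, ← map_sum, sum_lineDeriv_coordMul, ← inner_neg_left,
    ← map_neg, neg_add']
  rfl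

theorem toL2_mem_graph_xDotGrad (φ : 𝓢(Plane, ℂ)) :
    (toL2 φ, toL2 (xDG φ)) ∈ xDotGrad.graph :=
  (mem_graph_xDotGrad _ _).2 fun ψ => inner_xDGadj φ ψ

theorem neg_re_inner_laplacian (φ : 𝓢(Plane, ℂ)) :
    -(inner ℂ (toL2 φ) (toL2 (Δ φ))).re = ∑ i, ‖toL2 (∂_{unitVec i} φ)‖ ^ 2 := by
  rw [inner_laplacian, Complex.neg_re, neg_neg, Complex.re_sum]
  simp only [re_inner_self]

open FourierTransform in
/-- `4π² - Δ` maps the Schwartz space onto itself. -/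
theorem exists_shift_laplacian_eq (φ : 𝓢(Plane, ℂ)) :
    ∃ ψ : 𝓢(Plane, ℂ), (((2 * Real.pi) ^ 2 : ℝ) : ℂ) • ψ - Δ ψ = φ := by
  let c : ℝ := (2 * Real.pi) ^ 2
  have hc : 0 < c := by positivity
  -- With the normalization exp(-2πi x·ξ), Δ has symbol -4π²|ξ|². The shift 4π² makes the symbol
  -- 4π²(1 + |ξ|²), and `g` inverts its second factor.
  let g : Plane → ℝ := fun x => (1 + ‖x‖ ^ 2) ^ (-1 : ℝ)
  have hg : g.HasTemperateGrowth := Function.hasTemperateGrowth_one_add_norm_sq_rpow Plane (-1)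
  have hn : Function.HasTemperateGrowth (fun x : Plane => ‖x‖ ^ 2) :=
    Function.hasTemperateGrowth_norm_sq Plane
  let ψ₀ := SchwartzMap.fourierMultiplierCLM ℂ g φ
  refine ⟨c⁻¹ • ψ₀, ?_⟩
  have h1 : Δ (c⁻¹ • ψ₀) = -(SchwartzMap.fourierMultiplierCLM ℂ (fun x : Plane => ‖x‖ ^ 2) ψ₀) := by
    rw [SchwartzMap.laplacian_eq_fourierMultiplierCLM, map_smul, smul_smul, neg_mul,
      mul_inv_cancel₀ hc.ne', neg_one_smul]
  have h2 : ψ₀ = SchwartzMap.fourierMultiplierCLM ℂ (fun _ : Plane => (1 : ℝ)) ψ₀ := by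
    rw [SchwartzMap.fourierMultiplierCLM_const]; simp
  have h3 : ((c : ℝ) : ℂ) • c⁻¹ • ψ₀ = ψ₀ := by
    ext x
    simp [hc.ne']
  rw [h1, sub_neg_eq_add, h3]
  nth_rewrite 1 [h2]
  rw [SchwartzMap.fourierMultiplierCLM_fourierMultiplierCLM_apply (by fun_prop) hg,
    SchwartzMap.fourierMultiplierCLM_fourierMultiplierCLM_apply hn hg]
  rw [SchwartzMap.fourierMultiplierCLM_apply, SchwartzMap.fourierMultiplierCLM_apply,
    ← FourierTransform.fourierInv_add, ← add_apply, ← SchwartzMap.smulLeftCLM_add (by fun_prop)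
    (hn.mul hg)]
  have : (fun _ : Plane => (1 : ℝ)) * g + (fun x : Plane => ‖x‖ ^ 2) * g = fun _ => 1 := by
    ext x
    simp only [Pi.add_apply, Pi.mul_apply, g]
    rw [← add_mul, Real.rpow_neg_one, mul_inv_cancel₀ (by positivity)]
  rw [this, SchwartzMap.smulLeftCLM_const]
  simp

end Schwartz

end Schrodinger2D

end

noncomputable section

namespace Schrodinger2D

open Filter Topology

/-! ### The Laplacian and the Schrödinger operator -/

section Operators

theorem isClosed_graph_laplacian : IsClosed (laplacianL2.graph : Set (L2 × L2)) := by
  have : (laplacianL2.graph : Set (L2 × L2)) =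
      ⋂ ψ : 𝓢(Plane, ℂ), {p | inner ℂ (toL2 (Δ ψ)) p.1 = inner ℂ (toL2 ψ) p.2} := by
    ext ⟨f, g⟩
    rw [SetLike.mem_coe, mem_graph_laplacian, mem_iInter]
    rfl
  rw [this]
  exact isClosed_iInter fun ψ => isClosed_eq (by fun_prop) (by fun_prop)

theorem exists_seq_toL2_tendsto (f : L2) :
    ∃ φ : ℕ → 𝓢(Plane, ℂ), Tendsto (fun n => toL2 (φ n)) atTop (𝓝 f) := by
  obtain ⟨u, hu, hl⟩ := mem_closure_iff_seq_limit.1 (denseRange_toL2 f)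
  choose φ hφ using hu
  exact ⟨φ, by simpa only [hφ] using hl⟩

theorem eq_zero_of_inner_toL2 {f : L2} (h : ∀ ψ : 𝓢(Plane, ℂ), inner ℂ (toL2 ψ) f = 0) :
    f = 0 := by
  obtain ⟨φ, hφ⟩ := exists_seq_toL2_tendsto f
  have h1 : Tendsto (fun n => inner ℂ (toL2 (φ n)) f) atTop (𝓝 (inner ℂ f f)) :=
    hφ.inner tendsto_const_nhds
  simp only [h] at h1
  exact inner_self_eq_zero.1 (tendsto_nhds_unique h1 tendsto_const_nhds)

theorem eq_of_inner_toL2 {f g : L2}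
    (h : ∀ ψ : 𝓢(Plane, ℂ), inner ℂ (toL2 ψ) f = inner ℂ (toL2 ψ) g) : f = g := by
  refine sub_eq_zero.1 (eq_zero_of_inner_toL2 fun ψ => ?_)
  rw [inner_sub_right, h, sub_self]

theorem norm_toL2_le_shift {c : ℝ} (φ : 𝓢(Plane, ℂ)) :
    c * ‖toL2 φ‖ ≤ ‖toL2 ((c : ℂ) • φ - Δ φ)‖ := by
  rw [map_sub, map_smul, sub_eq_add_neg]
  refine norm_le_of_shift ?_
  rw [inner_neg_right, Complex.neg_re, neg_re_inner_laplacian]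
  positivity

/-- The Schwartz functions form a core of the Laplacian. -/
theorem exists_seq_tendsto_of_mem_graph_laplacian {f g : L2} (hfg : (f, g) ∈ laplacianL2.graph) :
    ∃ φ : ℕ → 𝓢(Plane, ℂ), Tendsto (fun n => toL2 (φ n)) atTop (𝓝 f) ∧
      Tendsto (fun n => toL2 (Δ (φ n))) atTop (𝓝 g) := by
  set c : ℝ := (2 * Real.pi) ^ 2 with hc
  have hc0 : 0 < c := by positivity
  -- Approximate (c - Δ)f by Schwartz functions and solve the equation inside the Schwartz space;
  -- coercivity makes the solutions Cauchy.
  obtain ⟨χ, hχ⟩ := exists_seq_toL2_tendsto ((c : ℂ) • f - g)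
  choose φ hφ using fun n => exists_shift_laplacian_eq (χ n)
  have hcau : CauchySeq fun n => toL2 (φ n) := by
    rw [Metric.cauchySeq_iff]
    intro ε hε
    obtain ⟨N, hN⟩ := Metric.cauchySeq_iff.1 hχ.cauchySeq (c * ε) (by positivity)
    refine ⟨N, fun m hm n hn => ?_⟩
    have h1 := hN m hm n hn
    rw [dist_eq_norm, ← map_sub] at h1 ⊢
    have h2 := norm_toL2_le_shift (c := c) (φ m - φ n)
    have h3 : (c : ℂ) • (φ m - φ n) - Δ (φ m - φ n) = χ m - χ n := by
      rw [← hφ m, ← hφ n]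
      rw [← SchwartzMap.laplacianCLM_eq ℂ (φ m - φ n), map_sub, SchwartzMap.laplacianCLM_eq,
        SchwartzMap.laplacianCLM_eq, smul_sub]
      abel
    rw [h3] at h2
    exact lt_of_mul_lt_mul_left (h2.trans_lt h1) hc0.le
  obtain ⟨f', hf'⟩ := cauchySeq_tendsto_of_complete hcau
  have hΔ : Tendsto (fun n => toL2 (Δ (φ n))) atTop (𝓝 ((c : ℂ) • f' - ((c : ℂ) • f - g))) := by
    have : ∀ n, toL2 (Δ (φ n)) = (c : ℂ) • toL2 (φ n) - toL2 (χ n) := by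
      intro n
      rw [← hφ n, map_sub, map_smul, sub_sub_cancel]
    simp only [this]
    exact (hf'.const_smul _).sub hχ
  have hmem : (f', (c : ℂ) • f' - ((c : ℂ) • f - g)) ∈ laplacianL2.graph :=
    isClosed_graph_laplacian.mem_of_tendsto (hf'.prodMk_nhds hΔ)
      (Eventually.of_forall fun n => toL2_mem_graph_laplacian (φ n))
  -- The functions (c - Δ)ψ exhaust the Schwartz space, so c - Δ is injective on the maximal domain.
  have hff : f' = f := by
    refine eq_of_inner_toL2 fun χ' => ?_
    obtain ⟨ψ, rfl⟩ := exists_shift_laplacian_eq χ'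
    have h1 := (mem_graph_laplacian _ _).1 hmem ψ
    have h2 := (mem_graph_laplacian _ _).1 hfg ψ
    rw [inner_sub_right, inner_sub_right] at h1
    rw [map_sub, map_smul, inner_sub_left, inner_sub_left, inner_smul_left, inner_smul_left,
      Complex.conj_ofReal, h1, h2, inner_smul_right, inner_smul_right]
    ring
  subst hff
  rw [sub_sub_cancel] at hΔ
  exact ⟨φ, hf', hΔ⟩

/-- Membership in the maximal domain only allows testing against Schwartz functions; the core
property replaces the test function by an arbitrary domain element. -/
theorem laplacian_symm {f g f' g' : L2} (h : (f, g) ∈ laplacianL2.graph)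
    (h' : (f', g') ∈ laplacianL2.graph) : inner ℂ g f' = inner ℂ f g' := by
  obtain ⟨φ, h1, h2⟩ := exists_seq_tendsto_of_mem_graph_laplacian h
  have e1 : Tendsto (fun n => inner ℂ (toL2 (Δ (φ n))) f') atTop (𝓝 (inner ℂ g f')) :=
    h2.inner tendsto_const_nhds
  have e2 : Tendsto (fun n => inner ℂ (toL2 (φ n)) g') atTop (𝓝 (inner ℂ f g')) :=
    h1.inner tendsto_const_nhds
  simp only [(mem_graph_laplacian _ _).1 h'] at e1
  exact tendsto_nhds_unique e1 e2

theorem laplacian_nonpos {f g : L2} (h : (f, g) ∈ laplacianL2.graph) :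
    (inner ℂ f g).re ≤ 0 := by
  obtain ⟨φ, h1, h2⟩ := exists_seq_tendsto_of_mem_graph_laplacian h
  have e := (Complex.continuous_re.tendsto _).comp (h1.inner (𝕜 := ℂ) h2)
  refine le_of_tendsto' e fun n => ?_
  rw [Function.comp_apply, ← neg_nonneg, neg_re_inner_laplacian]
  positivity

/-- Essential boundedness of a real potential, viewed as a complex function. -/
abbrev EssBdd (V : Plane → ℝ) : Prop := MemLp (fun x => ((V x : ℝ) : ℂ)) ∞ volume

theorem essBdd_of_measurable_of_le {V : Plane → ℝ} (hm : Measurable V) {M : ℝ}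
    (h : ∀ x, |V x| ≤ M) : EssBdd V :=
  memLp_top_of_bound (Complex.measurable_ofReal.comp hm).aestronglyMeasurable M
    (Eventually.of_forall fun x => by rw [Complex.norm_real]; exact h x)

theorem inner_mulOp {V : Plane → ℝ} (hV : EssBdd V) (f g : L2) :
    inner ℂ (mulOp V f) g = inner ℂ f (mulOp V g) := by
  rw [L2.inner_def, L2.inner_def]
  refine integral_congr_ae ?_
  filter_upwards [coeFn_mulOp hV f, coeFn_mulOp hV g] with x h1 h2
  rw [h1, h2, RCLike.inner_apply, RCLike.inner_apply, map_mul, Complex.conj_ofReal]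
  ring

theorem norm_mulOp_apply_le {V : Plane → ℝ} (hV : EssBdd V) {M : ℝ} (h : ∀ x, |V x| ≤ M) (f : L2) :
    ‖mulOp V f‖ ≤ M * ‖f‖ := by
  refine Lp.norm_le_mul_norm_of_ae_le_mul ?_
  filter_upwards [coeFn_mulOp hV f] with x h1
  rw [h1, norm_mul, Complex.norm_real]
  exact mul_le_mul_of_nonneg_right (h x) (norm_nonneg _)

theorem re_inner_mulOp_nonneg {V : Plane → ℝ} (hV : EssBdd V) (h0 : ∀ x, 0 ≤ V x) (f : L2) :
    0 ≤ (inner ℂ f (mulOp V f)).re := by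
  rw [L2.inner_def, ← RCLike.re_eq_complex_re, ← integral_re (L2.integrable_inner f _)]
  refine integral_nonneg_of_ae ?_
  filter_upwards [coeFn_mulOp hV f] with x h1
  simp only [h1, Pi.zero_apply, RCLike.re_eq_complex_re]
  rw [← smul_eq_mul, re_inner_ofReal_smul_right, re_inner_self]
  exact mul_nonneg (h0 x) (by positivity)

theorem mem_graph_negLapV (V : Plane → ℝ) (f h : L2) :
    (f, h) ∈ (negLapV V).graph ↔ (f, mulOp V f - h) ∈ laplacianL2.graph := by
  unfold negLapV
  simp only [LinearPMap.mem_graph_iff]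
  constructor
  · rintro ⟨y, hy, e⟩
    refine ⟨y, hy, ?_⟩
    rw [LinearPMap.vadd_apply, LinearPMap.neg_apply] at e
    rw [← e, ← hy]
    change _ = mulOp V _ - (mulOp V _ + _)
    abel
  · rintro ⟨y, hy, e⟩
    refine ⟨y, hy, ?_⟩
    rw [LinearPMap.vadd_apply, LinearPMap.neg_apply]
    change mulOp V (y : L2) + - laplacianL2 y = h
    rw [e, hy]
    abel

theorem toL2_mem_graph_negLapV (V : Plane → ℝ) (φ : 𝓢(Plane, ℂ)) :
    (toL2 φ, mulOp V (toL2 φ) - toL2 (Δ φ)) ∈ (negLapV V).graph := by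
  rw [mem_graph_negLapV, sub_sub_cancel]
  exact toL2_mem_graph_laplacian φ

theorem isClosed_graph_negLapV (V : Plane → ℝ) :
    IsClosed ((negLapV V).graph : Set (L2 × L2)) := by
  have : ((negLapV V).graph : Set (L2 × L2)) =
      (fun p : L2 × L2 => (p.1, mulOp V p.1 - p.2)) ⁻¹' laplacianL2.graph := by
    ext ⟨f, g⟩
    exact mem_graph_negLapV V f g
  rw [this]
  exact isClosed_graph_laplacian.preimage (by fun_prop)

/-- For the resolvent, let g be orthogonal to the range of τ + H. Testing with Schwartz functions
gives H g = -τ g in the sense of distributions, so g lies in the maximal domain, and non-negativity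
forces g = 0. -/
theorem isNonnegSelfAdjoint_negLapV {V : Plane → ℝ} (hV : EssBdd V) (h0 : ∀ x, 0 ≤ V x) :
    IsNonnegSelfAdjoint (negLapV V) := by
  have hn : ∀ {f h : L2}, (f, h) ∈ (negLapV V).graph → 0 ≤ (inner ℂ f h).re := by
    intro f h hf
    have h1 := laplacian_nonpos ((mem_graph_negLapV _ _ _).1 hf)
    rw [inner_sub_right, Complex.sub_re] at h1
    have := re_inner_mulOp_nonneg hV h0 f
    linarith
  refine ⟨fun f g => ?_, fun f => hn ((negLapV V).mem_graph f), fun τ hτ => ?_⟩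
  · have h := laplacian_symm ((mem_graph_negLapV _ _ _).1 ((negLapV V).mem_graph f))
      ((mem_graph_negLapV _ _ _).1 ((negLapV V).mem_graph g))
    rw [inner_sub_left, inner_sub_right, inner_mulOp hV] at h
    exact sub_right_inj.1 h
  · refine exists_isResolvent _ (isClosed_graph_negLapV V)
      (fun f => hn ((negLapV V).mem_graph f)) hτ fun g hg => ?_
    have hgraph : (g, -((τ : ℂ) • g)) ∈ (negLapV V).graph := by
      rw [mem_graph_negLapV, mem_graph_laplacian]
      intro ψ
      obtain ⟨y, hy, e⟩ := (LinearPMap.mem_graph_iff _).1 (toL2_mem_graph_negLapV V ψ)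
      have h1 := hg y
      simp only at hy e
      rw [hy, e, inner_add_left, inner_sub_left, inner_mulOp hV, inner_smul_left,
        Complex.conj_ofReal] at h1
      rw [inner_sub_right, inner_neg_right, inner_smul_right]
      linear_combination -h1
    have h2 := norm_le_of_shift (τ := τ) (hn hgraph)
    rw [add_neg_cancel, norm_zero] at h2
    have : ‖g‖ ≤ 0 := by
      by_contra hcon
      push Not at hcon
      nlinarith [mul_pos hτ hcon]
    exact norm_le_zero_iff.1 this

/-- The Schwartz functions form a core of the Schrödinger operator. -/
theorem exists_seq_tendsto_of_mem_graph_negLapV {V : Plane → ℝ} {f h : L2}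
    (hf : (f, h) ∈ (negLapV V).graph) :
    ∃ φ : ℕ → 𝓢(Plane, ℂ), Tendsto (fun n => toL2 (φ n)) atTop (𝓝 f) ∧
      Tendsto (fun n => mulOp V (toL2 (φ n)) - toL2 (Δ (φ n))) atTop (𝓝 h) := by
  obtain ⟨φ, h1, h2⟩ := exists_seq_tendsto_of_mem_graph_laplacian ((mem_graph_negLapV _ _ _).1 hf)
  refine ⟨φ, h1, ?_⟩
  have := (((mulOp V).continuous.tendsto f).comp h1).sub h2
  rwa [sub_sub_cancel] at this

end Operators

end Schrodinger2D

end

noncomputable section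

namespace Schrodinger2D

open Filter Topology

/-! ### A weighted form bound for the Laplacian in the plane -/

section FormBound

/-- The weight `(1 + |x|²) ^ p`. -/
def weight (p : ℝ) (x : Plane) : ℝ := (1 + ‖x‖ ^ 2) ^ p

theorem weight_pos (p : ℝ) (x : Plane) : 0 < weight p x := by
  unfold weight; positivity

theorem weight_le_one {p : ℝ} (hp : p ≤ 0) (x : Plane) : weight p x ≤ 1 :=
  Real.rpow_le_one_of_one_le_of_nonpos (by nlinarith [sq_nonneg ‖x‖]) hp

theorem measurable_weight (p : ℝ) : Measurable (weight p) := by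
  unfold weight; fun_prop

theorem weight_hasTemperateGrowth (p : ℝ) : (weight p).HasTemperateGrowth :=
  Function.hasTemperateGrowth_one_add_norm_sq_rpow Plane p

theorem hasFDerivAt_weight (p : ℝ) (x : Plane) :
    HasFDerivAt (weight p) ((p * (1 + ‖x‖ ^ 2) ^ (p - 1)) • ((2 : ℝ) • innerSL ℝ x)) x := by
  have h1 : HasFDerivAt (fun x : Plane => 1 + ‖x‖ ^ 2) ((2 : ℝ) • innerSL ℝ x) x := by
    have := ((hasStrictFDerivAt_norm_sq x).hasFDerivAt).const_add (1 : ℝ)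
    rwa [← Nat.cast_smul_eq_nsmul ℝ, Nat.cast_ofNat] at this
  exact h1.rpow_const (Or.inl (by positivity))

theorem coord_weight_hasTemperateGrowth (p : ℝ) (i : Fin 2) :
    Function.HasTemperateGrowth (fun x : Plane => ((x i * weight p x : ℝ) : ℂ)) := by
  have h1 : Function.HasTemperateGrowth (fun x : Plane => x i) :=
    (EuclideanSpace.proj i : Plane →L[ℝ] ℝ).hasTemperateGrowth
  have h2 := h1.mul (weight_hasTemperateGrowth p)
  exact Function.HasTemperateGrowth.comp Complex.ofRealCLM.hasTemperateGrowth h2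

/-- Multiplication of a Schwartz function by `xᵢ (1 + |x|²) ^ p`. -/
def coordWeightMul (p : ℝ) (i : Fin 2) (φ : 𝓢(Plane, ℂ)) : 𝓢(Plane, ℂ) :=
  SchwartzMap.smulLeftCLM ℂ (fun x : Plane => ((x i * weight p x : ℝ) : ℂ)) φ

theorem coordWeightMul_apply (p : ℝ) (i : Fin 2) (φ : 𝓢(Plane, ℂ)) (x : Plane) :
    coordWeightMul p i φ x = ((x i * weight p x : ℝ) : ℂ) * φ x := by
  unfold coordWeightMul
  rw [SchwartzMap.smulLeftCLM_apply_apply (coord_weight_hasTemperateGrowth p i), smul_eq_mul]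

theorem lineDeriv_coordWeightMul (p : ℝ) (i : Fin 2) (φ : 𝓢(Plane, ℂ)) (x : Plane) :
    ∂_{unitVec i} (coordWeightMul p i φ) x =
      ((weight p x + 2 * p * (x i) ^ 2 * weight (p - 1) x : ℝ) : ℂ) * φ x +
        ((x i * weight p x : ℝ) : ℂ) * ∂_{unitVec i} φ x := by
  rw [SchwartzMap.lineDerivOp_apply_eq_fderiv, SchwartzMap.lineDerivOp_apply_eq_fderiv]
  have h0 : HasFDerivAt (fun x : Plane => x i) (EuclideanSpace.proj i : Plane →L[ℝ] ℝ) x :=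
    (EuclideanSpace.proj i : Plane →L[ℝ] ℝ).hasFDerivAt
  have h1 := Complex.ofRealCLM.hasFDerivAt.comp x (h0.mul (hasFDerivAt_weight p x))
  have h2 := h1.mul (φ.hasFDerivAt x)
  have h3 : HasFDerivAt (coordWeightMul p i φ) _ x :=
    h2.congr_of_eventuallyEq (Eventually.of_forall fun y => coordWeightMul_apply p i φ y)
  rw [h3.fderiv]
  simp [weight, EuclideanSpace.inner_single_right]
  ring

/-- Split at τρ = 1: below it (τρ)^ε ≤ 1 and the first term dominates; above it (τρ)^(-1+2ε) ≤ 1, by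
ε ≤ 1/2, and the second does. -/
theorem rpow_mul_rpow_le_add {τ ρ ε : ℝ} (hτ : 0 < τ) (hρ : 0 < ρ) (h0 : 0 < ε) (h1 : ε ≤ 1 / 2) :
    τ ^ ε * ρ ^ (-1 + 2 * ε) ≤ ρ ^ (-1 + ε) + τ ^ (1 - ε) := by
  rcases le_total (τ * ρ) 1 with h | h
  · have e : τ ^ ε * ρ ^ (-1 + 2 * ε) = (τ * ρ) ^ ε * ρ ^ (-1 + ε) := by
      rw [Real.mul_rpow hτ.le hρ.le, mul_assoc, ← Real.rpow_add hρ]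
      ring_nf
    rw [e]
    have h2 : (τ * ρ) ^ ε ≤ 1 := Real.rpow_le_one (by positivity) h h0.le
    have h3 : 0 < ρ ^ (-1 + ε) := by positivity
    have h4 : 0 < τ ^ (1 - ε) := by positivity
    nlinarith
  · have e : τ ^ ε * ρ ^ (-1 + 2 * ε) = τ ^ (1 - ε) * (τ * ρ) ^ (-1 + 2 * ε) := by
      rw [Real.mul_rpow hτ.le hρ.le, ← mul_assoc, ← Real.rpow_add hτ]
      ring_nf
    rw [e]
    have h2 : (τ * ρ) ^ (-1 + 2 * ε) ≤ 1 :=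
      Real.rpow_le_one_of_one_le_of_nonpos h (by linarith)
    have h3 : 0 < ρ ^ (-1 + ε) := by positivity
    have h4 : 0 < τ ^ (1 - ε) := by positivity
    nlinarith

theorem norm_sq_plane (x : Plane) : ‖x‖ ^ 2 = x 0 ^ 2 + x 1 ^ 2 := by
  rw [EuclideanSpace.norm_sq_eq]; simp

theorem integrable_norm_sq (f : L2) : Integrable (fun x => ‖f x‖ ^ 2) :=
  (memLp_two_iff_integrable_sq_norm (Lp.aestronglyMeasurable f)).1 (Lp.memLp f)

theorem integral_norm_sq (f : L2) : ∫ x, ‖f x‖ ^ 2 = ‖f‖ ^ 2 := by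
  rw [← re_inner_self, L2.inner_def, ← RCLike.re_eq_complex_re,
    ← integral_re (L2.integrable_inner f f)]
  simp only [RCLike.re_eq_complex_re, re_inner_self]

theorem integrable_norm_sq_schwartz (φ : 𝓢(Plane, ℂ)) : Integrable (fun x => ‖φ x‖ ^ 2) := by
  refine (integrable_norm_sq (toL2 φ)).congr ?_
  filter_upwards [coeFn_toL2 φ] with x hx
  rw [hx]

theorem integral_norm_sq_schwartz (φ : 𝓢(Plane, ℂ)) : ∫ x, ‖φ x‖ ^ 2 = ‖toL2 φ‖ ^ 2 := by
  rw [← integral_norm_sq]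
  refine integral_congr_ae ?_
  filter_upwards [coeFn_toL2 φ] with x hx
  rw [hx]

/-- The pointwise inequality behind the weighted form bound. -/
theorem weighted_pointwise {τ ε : ℝ} (hτ : 0 < τ) (h0 : 0 < ε) (h1 : ε ≤ 1 / 2)
    (x : Plane) (z : ℂ) (d : Fin 2 → ℂ) :
    ε * (weight (-1 + ε) x * ‖z‖ ^ 2) - ε * τ ^ (1 - ε) * ‖z‖ ^ 2 -
        ε⁻¹ * (τ ^ ε)⁻¹ * ∑ i, ‖d i‖ ^ 2 ≤
      ∑ i, ((weight (-1 + ε) x + 2 * (-1 + ε) * (x i) ^ 2 * weight (-1 + ε - 1) x) * ‖z‖ ^ 2 +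
        2 * (x i * weight (-1 + ε) x) * ((starRingEnd ℂ) z * d i).re) := by
  set w := weight (-1 + ε) x with hw
  have hw0 : 0 < w := weight_pos _ _
  have hρ : 0 < 1 + ‖x‖ ^ 2 := by positivity
  have hT : 0 < τ ^ ε := by positivity
  have hx2 := norm_sq_plane x
  have hw1 : (1 + ‖x‖ ^ 2) * weight (-1 + ε - 1) x = w := by
    rw [hw, weight, weight, mul_comm, ← Real.rpow_add_one hρ.ne']; ring_nf
  have hw2 : ‖x‖ ^ 2 * (weight (-1 + ε - 1) x) ≤ w := by
    rw [← hw1]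
    have := weight_pos (-1 + ε - 1) x
    nlinarith
  have hww : τ ^ ε * (‖x‖ ^ 2 * w ^ 2) ≤ w + τ ^ (1 - ε) := by
    have e : (1 + ‖x‖ ^ 2) * w ^ 2 = (1 + ‖x‖ ^ 2) ^ (-1 + 2 * ε) := by
      rw [hw, weight, sq (_ ^ _ : ℝ), ← Real.rpow_add hρ, mul_comm, ← Real.rpow_add_one hρ.ne']
      ring_nf
    refine le_trans ?_ (rpow_mul_rpow_le_add hτ hρ h0 h1)
    rw [← e]
    gcongr
    linarith
  -- Young's inequality with weight ε τ^ε. The divergence of x w leaves at least 2ε w; by `hww` the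
  -- quadratic Young term costs at most ε (w + τ^(1-ε)), so ε w survives.
  have hy : ∀ i, -(ε * τ ^ ε * ((x i) ^ 2 * w ^ 2) * ‖z‖ ^ 2 + ε⁻¹ * (τ ^ ε)⁻¹ * ‖d i‖ ^ 2) ≤
      2 * (x i * w) * ((starRingEnd ℂ) z * d i).re := by
    intro i
    have hre : |((starRingEnd ℂ) z * d i).re| ≤ ‖z‖ * ‖d i‖ := by
      refine (Complex.abs_re_le_norm _).trans ?_
      rw [norm_mul, RCLike.norm_conj]
    have habs : |2 * (x i * w) * ((starRingEnd ℂ) z * d i).re| ≤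
        2 * (|x i * w| * ‖z‖) * ‖d i‖ := by
      rw [abs_mul, abs_mul, abs_two, mul_assoc, mul_assoc, mul_assoc]
      gcongr
    have hyoung : 2 * (|x i * w| * ‖z‖) * ‖d i‖ ≤
        ε * τ ^ ε * (|x i * w| * ‖z‖) ^ 2 + (ε * τ ^ ε)⁻¹ * ‖d i‖ ^ 2 := by
      set k := ε * τ ^ ε with hk
      have hk0 : 0 < k := by positivity
      set A := |x i * w| * ‖z‖
      set B := ‖d i‖
      have e : k * A ^ 2 + k⁻¹ * B ^ 2 - 2 * A * B = k⁻¹ * (k * A - B) ^ 2 := by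
        field_simp
        ring
      have : 0 ≤ k⁻¹ * (k * A - B) ^ 2 := by positivity
      linarith
    rw [mul_pow, sq_abs, mul_pow, mul_inv] at hyoung
    have := (abs_le.1 (habs.trans hyoung)).1
    linarith
  have hsum := add_le_add (hy 0) (hy 1)
  simp only [Fin.sum_univ_two]
  have hz : 0 ≤ ‖z‖ ^ 2 := by positivity
  have a1 : ε * (τ ^ ε * (‖x‖ ^ 2 * w ^ 2)) * ‖z‖ ^ 2 ≤ ε * (w + τ ^ (1 - ε)) * ‖z‖ ^ 2 := by
    gcongr
  have a2 : 2 * (1 - ε) * (‖x‖ ^ 2 * weight (-1 + ε - 1) x) * ‖z‖ ^ 2 ≤ 2 *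
      (1 - ε) * w * ‖z‖ ^ 2 := by
    have : 0 ≤ 1 - ε := by linarith
    gcongr
  rw [hx2] at a1 a2
  nlinarith

/-- The right side of `weighted_pointwise` is the divergence of x w |φ|² with w = (1 + |x|²)^(-1+ε),
and its integral vanishes. In the plane the field x |x|⁻² is divergence-free away from 0, so the
Hardy argument gains nothing at ε = 0; this is why the constants degenerate as ε → 0. -/
theorem weighted_form_bound_schwartz {τ ε : ℝ} (hτ : 0 < τ) (h0 : 0 < ε) (h1 : ε ≤ 1 / 2)
    (φ : 𝓢(Plane, ℂ)) :
    ε * ∫ x, weight (-1 + ε) x * ‖φ x‖ ^ 2 ≤ ε * τ ^ (1 - ε) * ‖toL2 φ‖ ^ 2 +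
        ε⁻¹ * (τ ^ ε)⁻¹ * ∑ i, ‖toL2 (∂_{unitVec i} φ)‖ ^ 2 := by
  set p : ℝ := -1 + ε
  have hz : ∀ i, ∫ x, (conjS (∂_{unitVec i} (coordWeightMul p i φ)) x * φ x +
      conjS (coordWeightMul p i φ) x * ∂_{unitVec i} φ x) = 0 := by
    intro i
    rw [integral_add, ← inner_toL2, ← inner_toL2, inner_lineDeriv, add_neg_cancel]
    · exact (SchwartzMap.pairing (ContinuousLinearMap.mul ℂ ℂ) _ φ).integrable
    · exact (SchwartzMap.pairing (ContinuousLinearMap.mul ℂ ℂ) _ (∂_{unitVec i} φ)).integrable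
  have hint : ∀ i, Integrable (fun x =>
      conjS (∂_{unitVec i} (coordWeightMul p i φ)) x * φ x +
      conjS (coordWeightMul p i φ) x * ∂_{unitVec i} φ x) := by
    intro i
    refine Integrable.add ?_ ?_
    · exact (SchwartzMap.pairing (ContinuousLinearMap.mul ℂ ℂ) _ φ).integrable
    · exact (SchwartzMap.pairing (ContinuousLinearMap.mul ℂ ℂ) _ (∂_{unitVec i} φ)).integrable
  have hre : ∀ i x, (conjS (∂_{unitVec i} (coordWeightMul p i φ)) x * φ x +
      conjS (coordWeightMul p i φ) x * ∂_{unitVec i} φ x).re =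
      (weight p x + 2 * p * (x i) ^ 2 * weight (p - 1) x) * ‖φ x‖ ^ 2 +
        2 * (x i * weight p x) * ((starRingEnd ℂ) (φ x) * ∂_{unitVec i} φ x).re := by
    intro i x
    rw [conjS_apply, conjS_apply, lineDeriv_coordWeightMul, coordWeightMul_apply, ← Complex.normSq_eq_norm_sq,
      Complex.normSq_apply]
    simp only [map_add, map_mul, Complex.conj_ofReal, Complex.add_re, Complex.mul_re,
      Complex.add_im, Complex.mul_im, Complex.ofReal_re, Complex.ofReal_im, Complex.conj_re,
      Complex.conj_im]
    ring
  have hzsum : ∫ x, ∑ i, ((weight p x + 2 * p * (x i) ^ 2 * weight (p - 1) x) * ‖φ x‖ ^ 2 +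
        2 * (x i * weight p x) * ((starRingEnd ℂ) (φ x) * ∂_{unitVec i} φ x).re) = 0 := by
    simp only [← hre]
    rw [integral_finsetSum _ fun i _ => by simpa using (hint i).re]
    refine Finset.sum_eq_zero fun i _ => ?_
    have := congrArg Complex.re (hz i)
    rw [← RCLike.re_eq_complex_re, ← integral_re (hint i)] at this
    simpa using this
  have hwi : Integrable (fun x => weight p x * ‖φ x‖ ^ 2) := by
    refine (integrable_norm_sq_schwartz φ).mono'
      ((measurable_weight p).aestronglyMeasurable.mul
        (integrable_norm_sq_schwartz φ).aestronglyMeasurable) (Eventually.of_forall fun x => ?_)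
    have := weight_pos p x
    rw [Real.norm_of_nonneg (by positivity)]
    exact mul_le_of_le_one_left (by positivity) (weight_le_one (by linarith) x)
  have hdi : Integrable (fun x => ∑ i, ‖∂_{unitVec i} φ x‖ ^ 2) :=
    integrable_finsetSum _ fun i _ => integrable_norm_sq_schwartz _
  have hL : Integrable (fun x => ε * (weight p x * ‖φ x‖ ^ 2) - ε * τ ^ (1 - ε) * ‖φ x‖ ^ 2 -
        ε⁻¹ * (τ ^ ε)⁻¹ * ∑ i, ‖∂_{unitVec i} φ x‖ ^ 2) :=
    ((hwi.const_mul _).sub ((integrable_norm_sq_schwartz φ).const_mul _)).sub (hdi.const_mul _)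
  have hR : Integrable (fun x => ∑ i, ((weight p x + 2 * p * (x i) ^ 2 * weight (p - 1) x) *
      ‖φ x‖ ^ 2 + 2 * (x i * weight p x) * ((starRingEnd ℂ) (φ x) * ∂_{unitVec i} φ x).re)) := by
    simp only [← hre]
    exact integrable_finsetSum _ fun i _ => (hint i).re
  have hmono := integral_mono hL hR fun x =>
    weighted_pointwise hτ h0 h1 x (φ x) (fun i => ∂_{unitVec i} φ x)
  have hA : Integrable (fun x => ε * (weight p x * ‖φ x‖ ^ 2) - ε * τ ^ (1 - ε) * ‖φ x‖ ^ 2) :=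
    (hwi.const_mul _).sub ((integrable_norm_sq_schwartz φ).const_mul _)
  rw [hzsum, integral_sub hA (hdi.const_mul _), integral_sub (hwi.const_mul _) ((integrable_norm_sq_schwartz φ).const_mul _),
    integral_const_mul, integral_const_mul, integral_const_mul,
    integral_finsetSum _ fun i _ => integrable_norm_sq_schwartz _] at hmono
  simp only [integral_norm_sq_schwartz] at hmono
  linarith

theorem re_inner_mulOp {V : Plane → ℝ} (hV : EssBdd V) (f : L2) :
    (inner ℂ f (mulOp V f)).re = ∫ x, V x * ‖f x‖ ^ 2 := by
  rw [L2.inner_def, ← RCLike.re_eq_complex_re, ← integral_re (L2.integrable_inner f _)]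
  refine integral_congr_ae ?_
  filter_upwards [coeFn_mulOp hV f] with x h1
  rw [h1, RCLike.re_eq_complex_re, ← smul_eq_mul, re_inner_ofReal_smul_right, re_inner_self]

theorem integrable_mul_norm_sq {V : Plane → ℝ} (hm : Measurable V) {M : ℝ} (hM : ∀ x, |V x| ≤ M)
    (f : L2) : Integrable (fun x => V x * ‖f x‖ ^ 2) := by
  refine ((integrable_norm_sq f).const_mul M).mono'
    (hm.aestronglyMeasurable.mul (integrable_norm_sq f).aestronglyMeasurable)
    (Eventually.of_forall fun x => ?_)
  rw [norm_mul, Real.norm_eq_abs, norm_pow, norm_norm]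
  gcongr
  exact hM x

/-- For Schwartz functions, V ≥ 0 bounds the gradient term by the form of H, and ε⁻² ≥ 1 merges the
two constants. Both sides pass to the limit along the Schwartz core because P is bounded. -/
theorem form_bound {V P : Plane → ℝ} (hV : EssBdd V) (hV0 : ∀ x, 0 ≤ V x) (hPm : Measurable P)
    {M : ℝ} (hM : 0 ≤ M) (hP0 : ∀ x, 0 ≤ P x) {τ ε : ℝ} (hτ : 0 < τ) (h0 : 0 < ε)
    (h1 : ε ≤ 1 / 2) (hP : ∀ x, P x ≤ M * weight (-1 + ε) x) {f h : L2}
    (hf : (f, h) ∈ (negLapV V).graph) :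
    (inner ℂ f (mulOp P f)).re ≤
      M * (ε⁻¹ ^ 2 * (τ ^ ε)⁻¹) * (τ * ‖f‖ ^ 2 + (inner ℂ f h).re) := by
  have hPM : ∀ x, |P x| ≤ M := fun x => by
    rw [abs_of_nonneg (hP0 x)]
    exact (hP x).trans (mul_le_of_le_one_right hM (weight_le_one (by linarith) x))
  have hPb := essBdd_of_measurable_of_le hPm hPM
  have hw1 : ∀ x, |weight (-1 + ε) x| ≤ 1 := fun x => by
    rw [abs_of_pos (weight_pos _ x)]
    exact weight_le_one (by linarith) x
  have hS : ∀ φ : 𝓢(Plane, ℂ), (inner ℂ (toL2 φ) (mulOp P (toL2 φ))).re ≤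
      M * (ε⁻¹ ^ 2 * (τ ^ ε)⁻¹) * (τ * ‖toL2 φ‖ ^ 2 +
        (inner ℂ (toL2 φ) (mulOp V (toL2 φ) - toL2 (Δ φ))).re) := by
    intro φ
    have hb := weighted_form_bound_schwartz hτ h0 h1 φ
    rw [re_inner_mulOp hPb, inner_sub_right, Complex.sub_re, sub_eq_add_neg,
      neg_re_inner_laplacian]
    have hVn := re_inner_mulOp_nonneg hV hV0 (toL2 φ)
    have hle : ∫ x, P x * ‖toL2 φ x‖ ^ 2 ≤ M * ∫ x, weight (-1 + ε) x * ‖φ x‖ ^ 2 := by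
      rw [← integral_const_mul]
      have e : ∫ x, M * (weight (-1 + ε) x * ‖φ x‖ ^ 2) =
          ∫ x, M * (weight (-1 + ε) x * ‖toL2 φ x‖ ^ 2) := by
        refine integral_congr_ae ?_
        filter_upwards [coeFn_toL2 φ] with x hx
        rw [hx]
      rw [e]
      refine integral_mono (integrable_mul_norm_sq hPm hPM _)
        ((integrable_mul_norm_sq (measurable_weight _) hw1 _).const_mul M) fun x => ?_
      rw [← mul_assoc]
      exact mul_le_mul_of_nonneg_right (hP x) (by positivity)
    refine hle.trans ?_
    rw [mul_assoc]
    refine mul_le_mul_of_nonneg_left ?_ hM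
    set S := ∑ i, ‖toL2 (∂_{unitVec i} φ)‖ ^ 2
    have hS0 : 0 ≤ S := by positivity
    set N := ‖toL2 φ‖ ^ 2
    have hN0 : 0 ≤ N := by positivity
    have hT : 0 < τ ^ ε := by positivity
    have eτ : τ ^ (1 - ε) = (τ ^ ε)⁻¹ * τ := by
      rw [Real.rpow_sub hτ, Real.rpow_one, div_eq_inv_mul]
    rw [eτ] at hb
    have hb' : ∫ x, weight (-1 + ε) x * ‖φ x‖ ^ 2 ≤
        (τ ^ ε)⁻¹ * τ * N + ε⁻¹ ^ 2 * (τ ^ ε)⁻¹ * S := by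
      have e : ε * ((τ ^ ε)⁻¹ * τ * N + ε⁻¹ ^ 2 * (τ ^ ε)⁻¹ * S) =
        ε * ((τ ^ ε)⁻¹ * τ) * N + ε⁻¹ * (τ ^ ε)⁻¹ * S := by
        field_simp
      rw [← e] at hb
      exact le_of_mul_le_mul_left hb h0
    refine hb'.trans ?_
    have hε1 : 1 ≤ ε⁻¹ ^ 2 := one_le_pow₀ ((one_le_inv₀ h0).2 (by linarith))
    have b1 : (τ ^ ε)⁻¹ * τ * N ≤ ε⁻¹ ^ 2 * ((τ ^ ε)⁻¹ * τ * N) :=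
      le_mul_of_one_le_left (by positivity) hε1
    have b2 : 0 ≤ ε⁻¹ ^ 2 * (τ ^ ε)⁻¹ * (inner ℂ (toL2 φ) (mulOp V (toL2 φ))).re := by positivity
    nlinarith
  obtain ⟨φ, hφ1, hφ2⟩ := exists_seq_tendsto_of_mem_graph_negLapV hf
  have l1 := (Complex.continuous_re.tendsto _).comp
    (hφ1.inner (𝕜 := ℂ) (((mulOp P).continuous.tendsto f).comp hφ1))
  have l2 := (Complex.continuous_re.tendsto _).comp (hφ1.inner (𝕜 := ℂ) hφ2)
  exact le_of_tendsto_of_tendsto' l1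
    ((((hφ1.norm.pow 2).const_mul τ).add l2).const_mul _) fun n => hS (φ n)

/-! ### Operator norm of R_τ W R_τ and absolute convergence of the integral. -/

theorem norm_inner_mulOp_le {W : Plane → ℝ} (hm : Measurable W) {M : ℝ} (hM : ∀ x, |W x| ≤ M)
    (u v : L2) : ‖inner ℂ u (mulOp W v)‖ ≤
      ((inner ℂ u (mulOp (fun x => |W x|) u)).re +
        (inner ℂ v (mulOp (fun x => |W x|) v)).re) / 2 := by
  have hma : Measurable fun x => |W x| := measurable_norm.comp hm
  have hMa : ∀ x, |(|W x|)| ≤ M := fun x => by rw [abs_abs]; exact hM x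
  rw [re_inner_mulOp (essBdd_of_measurable_of_le hma hMa),
    re_inner_mulOp (essBdd_of_measurable_of_le hma hMa), ← integral_add
    (integrable_mul_norm_sq hma hMa u) (integrable_mul_norm_sq hma hMa v), ← integral_div,
    L2.inner_def]
  refine norm_integral_le_of_norm_le (((integrable_mul_norm_sq hma hMa u).add
    (integrable_mul_norm_sq hma hMa v)).div_const 2) ?_
  filter_upwards [coeFn_mulOp (essBdd_of_measurable_of_le hm hM) v] with x hx
  rw [hx]
  refine (norm_inner_le_norm _ _).trans ?_
  rw [norm_mul, Complex.norm_real, Real.norm_eq_abs]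
  nlinarith [mul_nonneg (abs_nonneg (W x)) (sq_nonneg (‖u x‖ - ‖v x‖))]

theorem opNorm_le_of_inner_le {T : L2 →L[ℂ] L2} {K : ℝ} (hK : 0 ≤ K)
    (h : ∀ f g : L2, ‖inner ℂ f (T g)‖ ≤ K * (‖f‖ ^ 2 + ‖g‖ ^ 2) / 2) : ‖T‖ ≤ K := by
  refine T.opNorm_le_bound hK fun g => ?_
  rcases eq_or_ne (T g) 0 with h0 | h0
  · rw [h0, norm_zero]; positivity
  rcases eq_or_ne g 0 with rfl | hg
  · simp
  have hT : 0 < ‖T g‖ := norm_pos_iff.2 h0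
  have hg' : 0 < ‖g‖ := norm_pos_iff.2 hg
  -- The scaling gives the test vector the norm of g, so the sum of squares becomes the optimal
  -- product.
  have := h (((‖g‖ / ‖T g‖ : ℝ) : ℂ) • T g) g
  rw [inner_smul_left, Complex.conj_ofReal, norm_mul, norm_smul, Complex.norm_real,
    Real.norm_of_nonneg (by positivity), inner_self_eq_norm_sq_to_K, norm_pow] at this
  have e : ‖((‖T g‖ : ℝ) : ℂ)‖ = ‖T g‖ := by rw [Complex.norm_real, norm_norm]
  rw [RCLike.ofReal_eq_complex_ofReal, e, div_mul_cancel₀ _ hT.ne'] at this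
  have h2 : ‖g‖ / ‖T g‖ * ‖T g‖ ^ 2 = ‖g‖ * ‖T g‖ := by field_simp
  rw [h2] at this
  have h3 : ‖g‖ * ‖T g‖ ≤ ‖g‖ * (K * ‖g‖) := by nlinarith
  exact le_of_mul_le_mul_left h3 hg'

/-- The bound `‖(τ + H)⁻¹ W (τ + H)⁻¹‖ ≤ C τ ^ (-1 - ε)`. -/
theorem norm_res_mulOp_res_le {V W : Plane → ℝ} (hV : EssBdd V) (hV0 : ∀ x, 0 ≤ V x)
    (hm : Measurable W) {M : ℝ} (hM : 0 ≤ M) {τ ε : ℝ} (hτ : 0 < τ) (h0 : 0 < ε)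
    (h1 : ε ≤ 1 / 2) (hW : ∀ x, |W x| ≤ M * weight (-1 + ε) x) :
    ‖res V τ ∘L mulOp W ∘L res V τ‖ ≤ M * (ε⁻¹ ^ 2 * (τ ^ ε)⁻¹) * τ⁻¹ := by
  have hH := isNonnegSelfAdjoint_negLapV hV hV0
  have hWM : ∀ x, |W x| ≤ M := fun x =>
    (hW x).trans (mul_le_of_le_one_right hM (weight_le_one (by linarith) x))
  have hma : Measurable fun x => |W x| := measurable_norm.comp hm
  have hq : ∀ g : L2, (inner ℂ (res V τ g) (mulOp (fun x => |W x|) (res V τ g))).re ≤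
      M * (ε⁻¹ ^ 2 * (τ ^ ε)⁻¹) * τ⁻¹ * ‖g‖ ^ 2 := by
    intro g
    have hb := form_bound hV hV0 hma hM (fun x => abs_nonneg _) hτ h0 h1 hW
      (hH.res_mem_graph hτ g)
    refine hb.trans ?_
    rw [mul_assoc _ τ⁻¹]
    refine mul_le_mul_of_nonneg_left ?_ (by positivity)
    -- At u = R_τ g the shifted form τ‖u‖² + ⟨u, H u⟩ collapses to ⟨u, g⟩, which is at most τ⁻¹‖g‖².
    rw [inner_sub_right, Complex.sub_re, re_inner_ofReal_smul_right, re_inner_self,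
      add_sub_cancel]
    calc (inner ℂ (resolventOp (negLapV V) τ g) g).re
        ≤ ‖resolventOp (negLapV V) τ g‖ * ‖g‖ :=
          (Complex.re_le_norm _).trans (norm_inner_le_norm _ _)
      _ ≤ τ⁻¹ * ‖g‖ * ‖g‖ := by
          gcongr
          exact hH.norm_res_apply_le hτ g
      _ = _ := by ring
  refine opNorm_le_of_inner_le (by positivity) fun f g => ?_
  have e : inner ℂ f ((res V τ ∘L mulOp W ∘L res V τ) g) =
      inner ℂ (res V τ f) (mulOp W (res V τ g)) := (hH.inner_res hτ f _).symm
  rw [e]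
  refine (norm_inner_mulOp_le hm hWM _ _).trans ?_
  have := hq f
  have := hq g
  linarith

theorem norm_res_mulOp_res_le' {V W : Plane → ℝ} (hV : EssBdd V) (hV0 : ∀ x, 0 ≤ V x)
    (hW : EssBdd W) {M : ℝ} (hM : ∀ x, |W x| ≤ M) {τ : ℝ} (hτ : 0 < τ) :
    ‖res V τ ∘L mulOp W ∘L res V τ‖ ≤ M * τ⁻¹ ^ 2 := by
  have hH := isNonnegSelfAdjoint_negLapV hV hV0
  have hM0 : 0 ≤ M := (abs_nonneg _).trans (hM 0)
  refine ContinuousLinearMap.opNorm_le_bound _ (by positivity) fun g => ?_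
  calc ‖res V τ (mulOp W (res V τ g))‖ ≤ τ⁻¹ * (M * (τ⁻¹ * ‖g‖)) := by
        refine (hH.norm_res_apply_le hτ _).trans ?_
        gcongr
        refine (norm_mulOp_apply_le hW hM _).trans ?_
        gcongr
        exact hH.norm_res_apply_le hτ _
    _ = _ := by ring

theorem integrableOn_integrand_of_bounds {V : Plane → ℝ} (hV : EssBdd V) (hV0 : ∀ x, 0 ≤ V x)
    (hm : Measurable (potW V)) {M s : ℝ} (hs0 : 0 < s) (hs2 : s < 2)
    (hW : ∀ x, |potW V x| ≤ M * weight (-1) x) :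
    IntegrableOn (fun τ : ℝ => integrand V s τ) (Ioi 0) := by
  have hH := isNonnegSelfAdjoint_negLapV hV hV0
  -- Near 0 the integrand is of order τ^(s/2 - 1 - ε) = τ^(-1+ε), hence integrable, and s < 2
  -- ensures ε ≤ 1/2. Near infinity the order is τ^(s/2 - 2), integrable because s < 2.
  set ε : ℝ := s / 4 with hε
  have hM : 0 ≤ M := by
    have := (abs_nonneg _).trans (hW 0)
    exact nonneg_of_mul_nonneg_left this (weight_pos _ _)
  have hWM : ∀ x, |potW V x| ≤ M := fun x =>
    (hW x).trans (mul_le_of_le_one_right hM (weight_le_one (by norm_num) x))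
  have hWε : ∀ x, |potW V x| ≤ M * weight (-1 + ε) x := fun x => by
    refine (hW x).trans (mul_le_mul_of_nonneg_left ?_ hM)
    exact Real.rpow_le_rpow_of_exponent_le (by nlinarith [sq_nonneg ‖x‖]) (by linarith)
  have hWb := essBdd_of_measurable_of_le hm hWM
  have hc : ContinuousOn (fun τ : ℝ => integrand V s τ) (Ioi 0) := by
    unfold integrand
    have hr : ContinuousOn (fun τ => res V τ) (Ioi 0) := hH.continuousOn_res
    refine ContinuousOn.smul (M := ℂ) ?_ ?_
    · refine Complex.continuous_ofReal.comp_continuousOn ?_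
      exact (Real.continuous_rpow_const (by positivity)).continuousOn
    · exact hr.clm_comp (continuousOn_const.clm_comp hr)
  have hn : ∀ τ : ℝ, 0 < τ → ‖integrand V s τ‖ =
      τ ^ (s / 2) * ‖res V τ ∘L mulOp (potW V) ∘L res V τ‖ := fun τ hτ => by
    unfold integrand
    rw [norm_smul, Complex.norm_real, Real.norm_of_nonneg (by positivity)]
  rw [← Ioc_union_Ioi_eq_Ioi zero_le_one]
  refine IntegrableOn.union ?_ ?_
  · refine (((integrableOn_rpow_Ioc (p := -1 + ε) (by linarith)).const_mul
      (M * ε⁻¹ ^ 2))).mono' ((hc.mono Ioc_subset_Ioi_self).aestronglyMeasurable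
        measurableSet_Ioc) ?_
    refine (ae_restrict_iff' measurableSet_Ioc).2 (Eventually.of_forall fun τ hτ => ?_)
    have h2 : 0 < τ := hτ.1
    rw [hn τ h2]
    have hb := norm_res_mulOp_res_le hV hV0 hm hM h2 (by positivity : 0 < ε) (by linarith) hWε
    calc τ ^ (s / 2) * ‖res V τ ∘L mulOp (potW V) ∘L res V τ‖
        ≤ τ ^ (s / 2) * (M * (ε⁻¹ ^ 2 * (τ ^ ε)⁻¹) * τ⁻¹) := by gcongr
      _ = M * ε⁻¹ ^ 2 * (τ ^ (s / 2) * ((τ ^ ε)⁻¹ * τ⁻¹)) := by ring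
      _ = M * ε⁻¹ ^ 2 * τ ^ (-1 + ε) := by
        rw [← Real.rpow_neg h2.le, ← Real.rpow_neg_one τ, ← Real.rpow_add h2, ← Real.rpow_add h2]
        congr 2
        rw [hε]; ring
  · refine (((integrableOn_Ioi_rpow_of_lt (a := s / 2 - 2) (by linarith) one_pos).const_mul
      M)).mono' ((hc.mono (Ioi_subset_Ioi zero_le_one)).aestronglyMeasurable
        measurableSet_Ioi) ?_
    refine (ae_restrict_iff' measurableSet_Ioi).2 (Eventually.of_forall fun τ hτ => ?_)
    have h2 : 0 < τ := one_pos.trans hτ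
    rw [hn τ h2]
    have hb := norm_res_mulOp_res_le' hV hV0 hWb hWM h2
    calc τ ^ (s / 2) * ‖res V τ ∘L mulOp (potW V) ∘L res V τ‖
        ≤ τ ^ (s / 2) * (M * τ⁻¹ ^ 2) := by gcongr
      _ = M * τ ^ (s / 2 - 2) := by
        rw [Real.rpow_sub h2, Real.rpow_two]
        field_simp

end FormBound

end Schrodinger2D

end

noncomputable section

namespace Schrodinger2D

open Filter Topology

/-! ### Dilations of the plane -/

section Dilation

theorem quasiMeasurePreserving_smul_plane {c : ℝ} (hc : c ≠ 0) :
    Measure.QuasiMeasurePreserving (fun x : Plane => c • x) volume volume :=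
  ⟨measurable_const_smul c, by
    rw [Measure.map_addHaar_smul _ hc]
    exact Measure.smul_absolutelyContinuous⟩

theorem ae_exp_smul {P : Plane → Prop} (t : ℝ) (h : ∀ᵐ x, P x) :
    ∀ᵐ x : Plane, P (Real.exp t • x) :=
  (quasiMeasurePreserving_smul_plane (Real.exp_pos t).ne').ae h

/-- The dilation `x ↦ eᵗ f(eᵗ x)` of a function on the plane. -/
def dilFun (t : ℝ) (f : Plane → ℂ) (x : Plane) : ℂ :=
  ((Real.exp t : ℝ) : ℂ) * f (Real.exp t • x)

theorem memLp_dilFun (t : ℝ) {f : Plane → ℂ} (hf : MemLp f 2 volume) :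
    MemLp (dilFun t f) 2 volume := by
  refine MemLp.const_mul ?_ _
  have hm : AEStronglyMeasurable (fun x : Plane => f (Real.exp t • x)) volume :=
    hf.1.comp_quasiMeasurePreserving (quasiMeasurePreserving_smul_plane (Real.exp_pos t).ne')
  rw [memLp_two_iff_integrable_sq_norm hm]
  exact (integrable_comp_smul_iff volume (fun x => ‖f x‖ ^ 2) (Real.exp_pos t).ne').2
    ((memLp_two_iff_integrable_sq_norm hf.1).1 hf)

/-- The dilation as a linear map on `L²`. -/
def dilLM (t : ℝ) : L2 →ₗ[ℂ] L2 where
  toFun f := (memLp_dilFun t (Lp.memLp f)).toLp _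
  map_add' f g := by
    rw [← MemLp.toLp_add]
    refine MemLp.toLp_congr _ _ ?_
    filter_upwards [ae_exp_smul t (Lp.coeFn_add f g)] with x hx
    simp only [dilFun, Pi.add_apply, hx]
    ring
  map_smul' c f := by
    rw [RingHom.id_apply, ← MemLp.toLp_const_smul]
    refine MemLp.toLp_congr _ _ ?_
    filter_upwards [ae_exp_smul t (Lp.coeFn_smul c f)] with x hx
    simp only [dilFun, Pi.smul_apply, hx, smul_eq_mul]
    ring

theorem coeFn_dilLM (t : ℝ) (f : L2) : dilLM t f =ᵐ[volume] dilFun t f :=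
  MemLp.coeFn_toLp (memLp_dilFun t (Lp.memLp f))

/-- Change of variables y = eᵗx: the Jacobian e^(2t) of the plane is matched by the prefactor eᵗ, so
the adjoint is the inverse dilation. -/
theorem inner_dilLM (t : ℝ) (f g : L2) : inner ℂ (dilLM t f) g = inner ℂ f (dilLM (-t) g) := by
  rw [L2.inner_def, L2.inner_def]
  have h := Measure.integral_comp_smul (volume : Measure Plane)
    (fun y => dilFun (-t) g y * (starRingEnd ℂ) (f y)) (Real.exp t)
  have e1 : ∫ x, inner ℂ (dilLM t f x) (g x) =
      ∫ x, ((Real.exp t : ℝ) : ℂ) ^ 2 * (dilFun (-t) g (Real.exp t • x) *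
        (starRingEnd ℂ) (f (Real.exp t • x))) := by
    refine integral_congr_ae ?_
    filter_upwards [coeFn_dilLM t f] with x hx
    rw [hx, RCLike.inner_apply, dilFun, dilFun, map_mul, Complex.conj_ofReal, smul_smul,
      ← Real.exp_add, neg_add_cancel, Real.exp_zero, one_smul, Real.exp_neg, Complex.ofReal_inv]
    have : ((Real.exp t : ℝ) : ℂ) ≠ 0 := Complex.ofReal_ne_zero.2 (Real.exp_pos t).ne'
    field_simp
  have e2 : ∫ x, inner ℂ (f x) (dilLM (-t) g x) =
      ∫ y, dilFun (-t) g y * (starRingEnd ℂ) (f y) := by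
    refine integral_congr_ae ?_
    filter_upwards [coeFn_dilLM (-t) g] with x hx
    rw [hx, RCLike.inner_apply]
  rw [e1, e2, integral_const_mul, h, finrank_euclideanSpace_fin, abs_of_pos (by positivity),
    Complex.real_smul, ← mul_assoc]
  have : ((Real.exp t : ℝ) : ℂ) ≠ 0 := Complex.ofReal_ne_zero.2 (Real.exp_pos t).ne'
  push_cast
  rw [mul_inv_cancel₀ (by simp), one_mul]

theorem dilLM_neg_dilLM (t : ℝ) (f : L2) : dilLM (-t) (dilLM t f) = f := by
  refine Lp.ext ?_
  filter_upwards [coeFn_dilLM (-t) (dilLM t f), ae_exp_smul (-t) (coeFn_dilLM t f)] with x h1 h2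
  rw [h1, dilFun, h2, dilFun, smul_smul, ← Real.exp_add, add_neg_cancel, Real.exp_zero, one_smul,
    Real.exp_neg, ← mul_assoc, ← Complex.ofReal_mul, inv_mul_cancel₀ (Real.exp_pos t).ne',
    Complex.ofReal_one, one_mul]

/-- The unitary dilation `f ↦ eᵗ f(eᵗ ·)` on `L²`. -/
def dil (t : ℝ) : L2 →ₗᵢ[ℂ] L2 where
  toLinearMap := dilLM t
  norm_map' f := by
    have h : inner ℂ (dilLM t f) (dilLM t f) = inner ℂ f f := by
      rw [inner_dilLM, dilLM_neg_dilLM]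
    rw [← sq_eq_sq₀ (norm_nonneg _) (norm_nonneg _), ← re_inner_self, ← re_inner_self, h]

theorem coeFn_dil (t : ℝ) (f : L2) : dil t f =ᵐ[volume] dilFun t f := coeFn_dilLM t f

theorem inner_dil (t : ℝ) (f g : L2) : inner ℂ (dil t f) g = inner ℂ f (dil (-t) g) :=
  inner_dilLM t f g

theorem dil_neg_dil (t : ℝ) (f : L2) : dil (-t) (dil t f) = f := dilLM_neg_dilLM t f

theorem dil_dil_neg (t : ℝ) (f : L2) : dil t (dil (-t) f) = f := by
  simpa using dil_neg_dil (-t) f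

theorem dil_add (s t : ℝ) (f : L2) : dil s (dil t f) = dil (s + t) f := by
  refine Lp.ext ?_
  filter_upwards [coeFn_dil s (dil t f), ae_exp_smul s (coeFn_dil t f), coeFn_dil (s + t) f]
    with x h1 h2 h3
  rw [h1, dilFun, h2, dilFun, h3, dilFun, smul_smul, ← Real.exp_add, ← mul_assoc,
    ← Complex.ofReal_mul, ← Real.exp_add, add_comm t s]

theorem dil_zero (f : L2) : dil 0 f = f := by
  refine Lp.ext ?_
  filter_upwards [coeFn_dil 0 f] with x h1
  rw [h1, dilFun, Real.exp_zero, one_smul, Complex.ofReal_one, one_mul]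

/-- Scaling of the plane by `eᵗ`. -/
def scaleEquiv (t : ℝ) : Plane ≃L[ℝ] Plane :=
  ContinuousLinearEquiv.smulLeft (Units.mk0 (Real.exp t) (Real.exp_pos t).ne')

theorem scaleEquiv_apply (t : ℝ) (x : Plane) : scaleEquiv t x = Real.exp t • x := rfl

/-- Dilation of Schwartz functions. -/
def dilS (t : ℝ) (φ : 𝓢(Plane, ℂ)) : 𝓢(Plane, ℂ) :=
  ((Real.exp t : ℝ) : ℂ) • SchwartzMap.compCLMOfContinuousLinearEquiv ℂ (scaleEquiv t) φ

theorem dilS_apply (t : ℝ) (φ : 𝓢(Plane, ℂ)) (x : Plane) : dilS t φ x = dilFun t φ x := rfl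

theorem dil_toL2 (t : ℝ) (φ : 𝓢(Plane, ℂ)) : dil t (toL2 φ) = toL2 (dilS t φ) := by
  refine Lp.ext ?_
  filter_upwards [coeFn_dil t (toL2 φ), ae_exp_smul t (coeFn_toL2 φ), coeFn_toL2 (dilS t φ)]
    with x h1 h2 h3
  rw [h1, dilFun, h2, h3, dilS_apply, dilFun]

theorem lineDeriv_dilS (t : ℝ) (φ : 𝓢(Plane, ℂ)) (m : Plane) :
    ∂_{m} (dilS t φ) = ((Real.exp t : ℝ) : ℂ) • dilS t (∂_{m} φ) := by
  unfold dilS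
  rw [LineDeriv.lineDerivOp_smul, SchwartzMap.lineDerivOp_compCLMOfContinuousLinearEquiv,
    scaleEquiv_apply, LineDeriv.lineDerivOp_left_smul]
  ext x
  simp

theorem laplacian_dilS (t : ℝ) (φ : 𝓢(Plane, ℂ)) :
    Δ (dilS t φ) = ((Real.exp (2 * t) : ℝ) : ℂ) • dilS t (Δ φ) := by
  have hs : dilS t (∑ i, ∂_{unitVec i} (∂_{unitVec i} φ)) =
      ∑ i, dilS t (∂_{unitVec i} (∂_{unitVec i} φ)) := by
    unfold dilS
    rw [map_sum, Finset.smul_sum]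
  simp only [laplacian_eq, lineDeriv_dilS, LineDeriv.lineDerivOp_smul, smul_smul, hs,
    ← Finset.smul_sum, two_mul, Real.exp_add, Complex.ofReal_mul]

/-- Moving the dilation onto the test function reduces the scaling law to Schwartz functions. -/
theorem dil_mem_graph_laplacian (t : ℝ) {f g : L2} (h : (f, g) ∈ laplacianL2.graph) :
    (dil t f, ((Real.exp (2 * t) : ℝ) : ℂ) • dil t g) ∈ laplacianL2.graph := by
  rw [mem_graph_laplacian]
  intro ψ
  have h1 := (mem_graph_laplacian _ _).1 h (dilS (-t) ψ)
  rw [laplacian_dilS, map_smul, ← dil_toL2, ← dil_toL2, inner_smul_left, Complex.conj_ofReal,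
    inner_dil, inner_dil, neg_neg] at h1
  rw [inner_smul_right, ← h1, ← mul_assoc, ← Complex.ofReal_mul, ← Real.exp_add, mul_neg,
    add_neg_cancel, Real.exp_zero, Complex.ofReal_one, one_mul]

theorem essBdd_comp_smul {V : Plane → ℝ} {M : ℝ} (hm : Measurable V) (hM : ∀ x, |V x| ≤ M) (c : ℝ) :
    EssBdd fun x => V (c • x) :=
  essBdd_of_measurable_of_le (hm.comp (measurable_const_smul c)) fun _ => hM _

theorem dil_mulOp {V : Plane → ℝ} {M : ℝ} (hm : Measurable V) (hM : ∀ x, |V x| ≤ M) (t : ℝ)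
    (f : L2) : dil t (mulOp V f) = mulOp (fun x => V (Real.exp t • x)) (dil t f) := by
  refine Lp.ext ?_
  filter_upwards [coeFn_dil t (mulOp V f), coeFn_dil t f,
    ae_exp_smul t (coeFn_mulOp (essBdd_of_measurable_of_le hm hM) f),
    coeFn_mulOp (essBdd_comp_smul hm hM (Real.exp t)) (dil t f)] with x h1 h2 h3 h4
  rw [h1, dilFun, h3, h4, h2, dilFun]
  ring

/-! ### Dominated convergence in `L²` -/

theorem tendsto_L2_of_dominated {ι : Type*} {l : Filter ι} [l.IsCountablyGenerated] {F : ι → L2}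
    {G : L2} {f : ι → Plane → ℂ} {g : Plane → ℂ} {b : Plane → ℝ}
    (hF : ∀ t, F t =ᵐ[volume] f t) (hG : G =ᵐ[volume] g)
    (hb : Integrable (fun x => b x ^ 2)) (hle : ∀ᶠ t in l, ∀ᵐ x, ‖f t x - g x‖ ≤ b x)
    (hlim : ∀ᵐ x, Tendsto (fun t => f t x) l (𝓝 (g x))) : Tendsto F l (𝓝 G) := by
  have hn : ∀ t, ‖F t - G‖ ^ 2 = ∫ x, ‖f t x - g x‖ ^ 2 := by
    intro t
    rw [← integral_norm_sq]
    refine integral_congr_ae ?_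
    filter_upwards [Lp.coeFn_sub (F t) G, hF t, hG] with x h1 h2 h3
    rw [h1, Pi.sub_apply, h2, h3]
  have hlim2 : Tendsto (fun t => ∫ x, ‖f t x - g x‖ ^ 2) l (𝓝 (∫ _ : Plane, (0 : ℝ))) := by
    refine tendsto_integral_filter_of_dominated_convergence (fun x => b x ^ 2) ?_ ?_ hb ?_
    · refine Eventually.of_forall fun t => ?_
      refine ((integrable_norm_sq (F t - G)).congr ?_).aestronglyMeasurable
      filter_upwards [Lp.coeFn_sub (F t) G, hF t, hG] with x h1 h2 h3
      rw [h1, Pi.sub_apply, h2, h3]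
    · filter_upwards [hle] with t ht
      filter_upwards [ht] with x hx
      rw [norm_pow, norm_norm]
      gcongr
    · filter_upwards [hlim] with x hx
      have := ((hx.sub_const (g x)).norm).pow 2
      simpa using this
  rw [integral_zero] at hlim2
  simp only [← hn] at hlim2
  rw [tendsto_iff_norm_sub_tendsto_zero]
  have := hlim2.sqrt
  simpa [Real.sqrt_sq (norm_nonneg _)] using this

theorem integrable_weight_neg_one_sq (c : ℝ) :
    Integrable (fun x : Plane => (c * weight (-1) x) ^ 2) := by
  have h : Integrable (fun x : Plane => (1 + ‖x‖ ^ 2) ^ (-(4 : ℝ) / 2)) :=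
    integrable_rpow_neg_one_add_norm_sq (by
      rw [finrank_euclideanSpace_fin]; norm_num)
  refine (h.const_mul (c ^ 2)).congr (Eventually.of_forall fun x => ?_)
  have hρ : 0 < 1 + ‖x‖ ^ 2 := by positivity
  simp only [weight, mul_pow]
  rw [← Real.rpow_natCast ((1 + ‖x‖ ^ 2) ^ (-1 : ℝ)), ← Real.rpow_mul hρ.le]
  norm_num

theorem exists_schwartz_le_weight (χ : 𝓢(Plane, ℂ)) :
    ∃ K, 0 < K ∧ ∀ x, ‖χ x‖ ≤ K * weight (-1) x := by
  obtain ⟨K0, hK0, h0⟩ := χ.decay 0 0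
  obtain ⟨K2, hK2, h2⟩ := χ.decay 2 0
  refine ⟨K0 + K2, by positivity, fun x => ?_⟩
  have a0 := h0 x
  have a2 := h2 x
  rw [norm_iteratedFDeriv_zero] at a0 a2
  rw [pow_zero, one_mul] at a0
  rw [weight, Real.rpow_neg_one, ← div_eq_mul_inv, le_div_iff₀ (by positivity)]
  linarith

theorem weight_exp_smul_le {s : ℝ} (hs : s ∈ Icc (-1 : ℝ) 1) (x : Plane) :
    weight (-1) (Real.exp s • x) ≤ Real.exp 2 * weight (-1) x := by
  unfold weight
  rw [Real.rpow_neg_one, Real.rpow_neg_one, norm_smul, Real.norm_of_nonneg (Real.exp_pos s).le,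
    mul_pow, ← Real.exp_nat_mul, ← one_div, ← div_eq_mul_inv, div_le_div_iff₀ (by positivity)
    (by positivity), one_mul]
  have h1 : 1 ≤ Real.exp 2 := Real.one_le_exp (by norm_num)
  have h2 : 1 ≤ Real.exp 2 * Real.exp ((2 : ℕ) * s) := by
    rw [← Real.exp_add]
    refine Real.one_le_exp ?_
    push_cast
    linarith [hs.1]
  nlinarith [mul_le_mul_of_nonneg_right h2 (sq_nonneg ‖x‖)]

theorem hasDerivAt_exp_smul (s : ℝ) (x : Plane) :
    HasDerivAt (fun s : ℝ => Real.exp s • x) (Real.exp s • x) s :=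
  (Real.hasDerivAt_exp s).smul_const x

/-- The summand φ is the derivative of the prefactor eˢ. It makes the generator D + 1, and is the
reason limits of difference quotients below have the form g + f. -/
theorem hasDerivAt_dilFun (φ : 𝓢(Plane, ℂ)) (s : ℝ) (x : Plane) :
    HasDerivAt (fun s => dilFun s φ x) (dilFun s (φ + xDG φ : 𝓢(Plane, ℂ)) x) s := by
  have h1 : HasDerivAt (fun s : ℝ => ((Real.exp s : ℝ) : ℂ)) ((Real.exp s : ℝ) : ℂ) s :=
    (Real.hasDerivAt_exp s).ofReal_comp
  have h2 := (φ.hasFDerivAt (Real.exp s • x)).comp_hasDerivAt s (hasDerivAt_exp_smul s x)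
  refine (h1.mul h2).congr_deriv ?_
  rw [dilFun, add_apply, xDG_apply]
  simp only [Function.comp_apply]
  ring

/-- A function on `ℝ` with derivative at most `B` on `[-1, 1]` has difference quotients at most
`B`. -/
theorem norm_inv_smul_sub_le {h h' : ℝ → ℂ} {B : ℝ} (hd : ∀ s, HasDerivAt h (h' s) s)
    (hB : ∀ s ∈ Icc (-1 : ℝ) 1, ‖h' s‖ ≤ B) {t : ℝ} (ht : t ∈ Icc (-1 : ℝ) 1) :
    ‖((t : ℝ) : ℂ)⁻¹ * (h t - h 0)‖ ≤ B := by
  have hB0 : 0 ≤ B := (norm_nonneg _).trans (hB 0 (by norm_num))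
  have hm := Convex.norm_image_sub_le_of_norm_hasDerivWithin_le
    (fun s _ => (hd s).hasDerivWithinAt) hB (convex_Icc (-1 : ℝ) 1)
    (by norm_num : (0 : ℝ) ∈ Icc (-1 : ℝ) 1) ht
  rw [sub_zero] at hm
  rcases eq_or_ne t 0 with rfl | h0
  · simpa using hB0
  rw [norm_mul, norm_inv, Complex.norm_real, inv_mul_le_iff₀ (norm_pos_iff.2 h0), mul_comm]
  exact hm

theorem tendsto_inv_mul_sub {h : ℝ → ℂ} {h' : ℂ} (hd : HasDerivAt h h' 0) :
    Tendsto (fun t : ℝ => ((t : ℝ) : ℂ)⁻¹ * (h t - h 0)) (𝓝[≠] 0) (𝓝 h') := by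
  have := hasDerivAt_iff_tendsto_slope.1 hd
  refine this.congr fun t => ?_
  rw [slope_def_module, sub_zero, Complex.real_smul, Complex.ofReal_inv]

theorem eventually_mem_Icc : ∀ᶠ t : ℝ in 𝓝[≠] 0, t ∈ Icc (-1 : ℝ) 1 :=
  eventually_nhdsWithin_of_eventually_nhds (Icc_mem_nhds (by norm_num) (by norm_num))

/-- The difference quotient of the dilations. -/
def dilQuot (t : ℝ) (f : L2) : L2 := ((t : ℝ) : ℂ)⁻¹ • (dil t f - f)

/-- The generator of the dilations on Schwartz functions. -/
theorem tendsto_dilQuot_toL2 (φ : 𝓢(Plane, ℂ)) :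
    Tendsto (fun t => dilQuot t (toL2 φ)) (𝓝[≠] 0) (𝓝 (toL2 (φ + xDG φ))) := by
  set χ : 𝓢(Plane, ℂ) := φ + xDG φ with hχ
  obtain ⟨K, hK, hKb⟩ := exists_schwartz_le_weight χ
  have hbd : ∀ x, ∀ s ∈ Icc (-1 : ℝ) 1, ‖dilFun s χ x‖ ≤
      Real.exp 1 * (K * (Real.exp 2 * weight (-1) x)) := by
    intro x s hs
    rw [dilFun, norm_mul, Complex.norm_real, Real.norm_of_nonneg (Real.exp_pos s).le]
    have h1 := hKb (Real.exp s • x)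
    have h2 := weight_exp_smul_le hs x
    have h3 := hs.2
    gcongr
    exact h1.trans (by gcongr)
  have h00 : ∀ x, dilFun 0 φ x = φ x := fun x => by
    rw [dilFun, Real.exp_zero, one_smul, Complex.ofReal_one, one_mul]
  have h01 : ∀ x, dilFun 0 χ x = χ x := fun x => by
    rw [dilFun, Real.exp_zero, one_smul, Complex.ofReal_one, one_mul]
  refine tendsto_L2_of_dominated
    (f := fun t x => ((t : ℝ) : ℂ)⁻¹ * (dilFun t φ x - dilFun 0 φ x)) (g := χ)
    -- One half bounds the difference quotient, by the mean value inequality for |s| ≤ 1, and the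
    -- other half bounds its limit.
    (b := fun x => (2 * (Real.exp 1 * (K * Real.exp 2))) * weight (-1) x)
    (fun t => ?_) (coeFn_toL2 χ) (integrable_weight_neg_one_sq _) ?_ ?_
  · unfold dilQuot
    filter_upwards [Lp.coeFn_smul ((t : ℝ) : ℂ)⁻¹ (dil t (toL2 φ) - toL2 φ),
      Lp.coeFn_sub (dil t (toL2 φ)) (toL2 φ), coeFn_dil t (toL2 φ), ae_exp_smul t (coeFn_toL2 φ),
      coeFn_toL2 φ] with x h1 h2 h3 h4 h5
    rw [h1, Pi.smul_apply, h2, Pi.sub_apply, h3, dilFun, h4, h5, smul_eq_mul, h00, dilFun]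
  · filter_upwards [eventually_mem_Icc] with t ht
    refine Eventually.of_forall fun x => (norm_sub_le _ _).trans ?_
    have h1 := norm_inv_smul_sub_le (fun s => hasDerivAt_dilFun φ s x) (hbd x) ht
    have h2 := hbd x 0 (by norm_num)
    rw [h01] at h2
    linarith
  · refine Eventually.of_forall fun x => ?_
    have := tendsto_inv_mul_sub (hasDerivAt_dilFun φ 0 x)
    rwa [← hχ, h01] at this

theorem tendsto_ofReal_nhdsNE : Tendsto (fun t : ℝ => ((t : ℝ) : ℂ)) (𝓝[≠] 0) (𝓝 0) := by
  have : Tendsto (fun t : ℝ => ((t : ℝ) : ℂ)) (𝓝 0) (𝓝 ((0 : ℝ) : ℂ)) :=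
    Complex.continuous_ofReal.tendsto 0
  rw [Complex.ofReal_zero] at this
  exact this.mono_left nhdsWithin_le_nhds

theorem ofReal_smul_dilQuot {t : ℝ} (ht : t ≠ 0) (f : L2) :
    ((t : ℝ) : ℂ) • dilQuot t f = dil t f - f := by
  unfold dilQuot
  rw [smul_smul, mul_inv_cancel₀ (Complex.ofReal_ne_zero.2 ht), one_smul]

/-- Strong continuity of the dilations. -/
theorem tendsto_dil (f : L2) : Tendsto (fun t => dil t f) (𝓝[≠] 0) (𝓝 f) := by
  have hS : ∀ φ : 𝓢(Plane, ℂ), Tendsto (fun t => dil t (toL2 φ)) (𝓝[≠] 0) (𝓝 (toL2 φ)) := by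
    intro φ
    have h := (tendsto_ofReal_nhdsNE.smul (tendsto_dilQuot_toL2 φ)).add_const (toL2 φ)
    rw [zero_smul, zero_add] at h
    refine h.congr' ?_
    filter_upwards [self_mem_nhdsWithin] with t ht
    rw [ofReal_smul_dilQuot ht, sub_add_cancel]
  rw [Metric.tendsto_nhds]
  intro ε hε
  obtain ⟨φ, hφ⟩ := denseRange_toL2.exists_dist_lt f (by positivity : 0 < ε / 3)
  filter_upwards [Metric.tendsto_nhds.1 (hS φ) (ε / 3) (by positivity)] with t ht
  have h1 : dist (dil t f) (dil t (toL2 φ)) < ε / 3 := by rwa [(dil t).dist_map]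
  calc dist (dil t f) f ≤ dist (dil t f) (dil t (toL2 φ)) + dist (dil t (toL2 φ)) (toL2 φ) +
        dist (toL2 φ) f := dist_triangle4 _ _ _ _
    _ < ε / 3 + ε / 3 + ε / 3 := by
        rw [dist_comm (toL2 φ) f]
        gcongr
    _ = ε := by ring

theorem tendsto_neg_nhdsNE : Tendsto (fun t : ℝ => -t) (𝓝[≠] 0) (𝓝[≠] 0) := by
  refine tendsto_nhdsWithin_iff.2 ⟨?_, ?_⟩
  · have : Tendsto (fun t : ℝ => -t) (𝓝 0) (𝓝 (-0)) := (continuous_neg.tendsto 0)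
    rw [neg_zero] at this
    exact this.mono_left nhdsWithin_le_nhds
  · filter_upwards [self_mem_nhdsWithin] with t ht
    exact neg_ne_zero.2 ht

theorem inner_dilQuot (t : ℝ) (f g : L2) :
    inner ℂ f (dilQuot t g) = -inner ℂ (dilQuot (-t) f) g := by
  unfold dilQuot
  rw [inner_smul_right, inner_smul_left, inner_sub_right, inner_sub_left, inner_dil, neg_neg,
    Complex.ofReal_neg, map_inv₀, map_neg, Complex.conj_ofReal]
  ring

/-! ### Weak differentiability of the dilations on the maximal domain of x · ∇. -/

theorem inner_xDGadj_add {f g : L2} (h : (f, g) ∈ xDotGrad.graph) (ψ : 𝓢(Plane, ℂ)) :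
    -inner ℂ (toL2 (ψ + xDG ψ)) f = inner ℂ (toL2 ψ) (g + f) := by
  rw [inner_add_right, ← (mem_graph_xDotGrad _ _).1 h ψ]
  unfold xDGadj
  simp only [map_sub, map_neg, map_add, map_smul, inner_sub_left, inner_neg_left, inner_add_left,
    inner_smul_left, Complex.conj_ofNat]
  ring

/-- If the dilations of `f` are differentiable then `f` lies in the domain of `x · ∇`. -/
theorem mem_graph_xDotGrad_of_tendsto {f g : L2}
    (h : Tendsto (fun t => dilQuot t f) (𝓝[≠] 0) (𝓝 (g + f))) : (f, g) ∈ xDotGrad.graph := by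
  rw [mem_graph_xDotGrad]
  intro ψ
  have h1 : Tendsto (fun t => inner ℂ (toL2 ψ) (dilQuot t f)) (𝓝[≠] 0)
      (𝓝 (inner ℂ (toL2 ψ) (g + f))) := tendsto_const_nhds.inner h
  have h2 : Tendsto (fun t => -inner ℂ (dilQuot (-t) (toL2 ψ)) f) (𝓝[≠] 0)
      (𝓝 (-inner ℂ (toL2 (ψ + xDG ψ)) f)) :=
    (((tendsto_dilQuot_toL2 ψ).comp tendsto_neg_nhdsNE).inner tendsto_const_nhds).neg
  simp only [inner_dilQuot] at h1
  have e := tendsto_nhds_unique h1 h2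
  rw [inner_add_right] at e
  unfold xDGadj
  simp only [map_sub, map_neg, map_add, map_smul, inner_sub_left, inner_neg_left, inner_add_left,
    inner_smul_left, Complex.conj_ofNat] at e ⊢
  linear_combination -e

theorem norm_le_of_inner_toL2 {u : L2} {C : ℝ} (hC : 0 ≤ C)
    (h : ∀ ψ : 𝓢(Plane, ℂ), ‖inner ℂ (toL2 ψ) u‖ ≤ C * ‖toL2 ψ‖) : ‖u‖ ≤ C := by
  obtain ⟨φ, hφ⟩ := exists_seq_toL2_tendsto u
  have h1 : Tendsto (fun n => ‖inner ℂ (toL2 (φ n)) u‖) atTop (𝓝 ‖inner ℂ u u‖) :=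
    (hφ.inner tendsto_const_nhds).norm
  have h2 := le_of_tendsto_of_tendsto' h1 (hφ.norm.const_mul C) fun n => h (φ n)
  rw [inner_self_eq_norm_sq_to_K, norm_pow, RCLike.norm_ofReal, abs_norm] at h2
  rcases eq_or_ne u 0 with rfl | hu
  · rwa [norm_zero]
  · have hu' := norm_pos_iff.2 hu
    rw [sq] at h2
    exact le_of_mul_le_mul_right h2 hu'

/-- The dilation is moved onto the Schwartz function, where it is strongly differentiable; f
contributes only f, D f ∈ L². The resulting derivative bound gives the uniform bound on difference
quotients. -/
theorem hasDerivAt_inner_dil {f g : L2} (h : (f, g) ∈ xDotGrad.graph) (ψ : 𝓢(Plane, ℂ)) (t : ℝ) :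
    HasDerivAt (fun t => inner ℂ (toL2 ψ) (dil t f)) (inner ℂ (dil (-t) (toL2 ψ)) (g + f)) t := by
  rw [hasDerivAt_iff_tendsto_slope_zero, dil_toL2, ← inner_xDGadj_add h]
  have h2 : Tendsto (fun s => -inner ℂ (dilQuot (-s) (toL2 (dilS (-t) ψ))) f) (𝓝[≠] 0)
      (𝓝 (-inner ℂ (toL2 (dilS (-t) ψ + xDG (dilS (-t) ψ))) f)) :=
    (((tendsto_dilQuot_toL2 _).comp tendsto_neg_nhdsNE).inner tendsto_const_nhds).neg
  refine h2.congr fun s => ?_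
  rw [← inner_dilQuot, ← dil_toL2, inner_dil, neg_neg]
  unfold dilQuot
  rw [map_smul, map_sub, dil_add, inner_smul_right, inner_sub_right, Complex.real_smul,
    Complex.ofReal_inv]

theorem norm_dil_sub_le {f g : L2} (h : (f, g) ∈ xDotGrad.graph) (t : ℝ) :
    ‖dil t f - f‖ ≤ |t| * ‖g + f‖ := by
  refine norm_le_of_inner_toL2 (by positivity) fun ψ => ?_
  have hm := Convex.norm_image_sub_le_of_norm_hasDerivWithin_le (C := ‖toL2 ψ‖ * ‖g + f‖)
    (fun s _ => (hasDerivAt_inner_dil h ψ s).hasDerivWithinAt)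
    (fun s _ => (norm_inner_le_norm _ _).trans (by rw [(dil (-s)).norm_map])) convex_univ
    (mem_univ 0) (mem_univ t)
  rw [dil_zero, ← inner_sub_right, sub_zero, Real.norm_eq_abs] at hm
  linarith

theorem norm_dilQuot_le {f g : L2} (h : (f, g) ∈ xDotGrad.graph) (t : ℝ) :
    ‖dilQuot t f‖ ≤ ‖g + f‖ := by
  rcases eq_or_ne t 0 with rfl | ht
  · simp [dilQuot]
  · have := norm_dil_sub_le h t
    rw [← ofReal_smul_dilQuot ht, norm_smul, Complex.norm_real, Real.norm_eq_abs] at this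
    exact le_of_mul_le_mul_left this (abs_pos.2 ht)

/-- Uniformly bounded quotients that converge against the dense set of Schwartz functions converge
weakly. -/
theorem tendsto_inner_dilQuot {f g : L2} (h : (f, g) ∈ xDotGrad.graph) (v : L2) :
    Tendsto (fun t => inner ℂ v (dilQuot t f)) (𝓝[≠] 0) (𝓝 (inner ℂ v (g + f))) := by
  have hS : ∀ ψ : 𝓢(Plane, ℂ), Tendsto (fun t => inner ℂ (toL2 ψ) (dilQuot t f)) (𝓝[≠] 0)
      (𝓝 (inner ℂ (toL2 ψ) (g + f))) := by
    intro ψ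
    have := tendsto_inv_mul_sub (hasDerivAt_inner_dil h ψ 0)
    simp only [neg_zero, dil_zero] at this
    refine this.congr fun t => ?_
    unfold dilQuot
    rw [← inner_sub_right, inner_smul_right]
  rw [Metric.tendsto_nhds]
  intro ε hε
  set K := ‖g + f‖ + 1 with hK
  have hK0 : 0 < K := by positivity
  obtain ⟨ψ, hψ⟩ := denseRange_toL2.exists_dist_lt v (by positivity : 0 < ε / (3 * K))
  have hb : ∀ w : L2, ‖w‖ ≤ ‖g + f‖ → dist (inner ℂ v w) (inner ℂ (toL2 ψ) w) ≤ ε / 3 := by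
    intro w hw
    rw [dist_eq_norm, ← inner_sub_left]
    rw [dist_eq_norm] at hψ
    calc ‖inner ℂ (v - toL2 ψ) w‖ ≤ ‖v - toL2 ψ‖ * ‖w‖ := norm_inner_le_norm _ _
      _ ≤ ε / (3 * K) * K := by
        gcongr
        linarith
      _ = ε / 3 := by field_simp
  filter_upwards [Metric.tendsto_nhds.1 (hS ψ) (ε / 3) (by positivity)] with t ht
  have h1 := hb _ (norm_dilQuot_le h t)
  have h2 := hb (g + f) le_rfl
  rw [dist_comm] at h2
  have := dist_triangle4 (inner ℂ v (dilQuot t f)) (inner ℂ (toL2 ψ) (dilQuot t f))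
    (inner ℂ (toL2 ψ) (g + f)) (inner ℂ v (g + f))
  linarith

/-- Integration by parts for `x · ∇` on its maximal domain. -/
theorem inner_xDotGrad {f g f' g' : L2} (h : (f, g) ∈ xDotGrad.graph)
    (h' : (f', g') ∈ xDotGrad.graph) :
    inner ℂ f' g = -inner ℂ g' f - 2 * inner ℂ f' f := by
  -- The difference quotient is passed from f to f' by the adjoint relation. Each side pairs one
  -- quotient with a fixed vector, so weak convergence suffices and the two limits agree.
  have h1 := tendsto_inner_dilQuot h f'
  have h2 : Tendsto (fun t => -inner ℂ (dilQuot (-t) f') f) (𝓝[≠] 0)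
      (𝓝 (-inner ℂ (g' + f') f)) := by
    have := (Complex.continuous_conj.tendsto _).comp
      ((tendsto_inner_dilQuot h' f).comp tendsto_neg_nhdsNE)
    rw [inner_conj_symm] at this
    refine this.neg.congr fun t => ?_
    simp only [Function.comp_apply, inner_conj_symm]
  simp only [inner_dilQuot] at h1
  have e := tendsto_nhds_unique h1 h2
  rw [inner_add_right, inner_add_left] at e
  linear_combination e

end Dilation

end Schrodinger2D

end

noncomputable section

namespace Schrodinger2D

open Filter Topology

/-! ### The commutator of the dilations with the resolvent -/

section Commutator

/-- The difference quotients of a potential along the dilations. -/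
theorem tendsto_inv_smul_mulOp_sub {V : Plane → ℝ} {C : ℝ} (hV1 : ContDiff ℝ 1 V)
    (hC : ∀ x, |V x| ≤ C) (hC' : ∀ x, |fderiv ℝ V x x| ≤ C) (f : L2) :
    Tendsto (fun t : ℝ => ((t : ℝ) : ℂ)⁻¹ • (mulOp (fun x => V (Real.exp t • x)) f - mulOp V f))
      (𝓝[≠] 0) (𝓝 (mulOp (fun x => fderiv ℝ V x x) f)) := by
  have hm := hV1.continuous.measurable
  have hm' : Measurable fun x => fderiv ℝ V x x :=
    ((hV1.continuous_fderiv one_ne_zero).clm_apply continuous_id).measurable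
  -- Along a dilation orbit the derivative of V is x · ∇V at the moved point, so the bound on x · ∇V
  -- controls the quotients; no bound on ∇V itself is involved.
  have hd : ∀ (x : Plane) (s : ℝ), HasDerivAt (fun s : ℝ => ((V (Real.exp s • x) : ℝ) : ℂ))
      ((fderiv ℝ V (Real.exp s • x) (Real.exp s • x) : ℝ) : ℂ) s := fun x s =>
    (((hV1.differentiable one_ne_zero _).hasFDerivAt).comp_hasDerivAt s
      (hasDerivAt_exp_smul s x)).ofReal_comp
  have hbd : ∀ (x : Plane), ∀ s ∈ Icc (-1 : ℝ) 1,
      ‖((fderiv ℝ V (Real.exp s • x) (Real.exp s • x) : ℝ) : ℂ)‖ ≤ C := fun x s _ => by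
    rw [Complex.norm_real]
    exact hC' _
  refine tendsto_L2_of_dominated
    (f := fun t x => ((t : ℝ) : ℂ)⁻¹ *
      (((V (Real.exp t • x) : ℝ) : ℂ) - ((V (Real.exp 0 • x) : ℝ) : ℂ)) * f x)
    (b := fun x => (2 * C) * ‖f x‖) (fun t => ?_)
    (coeFn_mulOp (essBdd_of_measurable_of_le hm' hC') f) ?_ ?_ ?_
  · filter_upwards [Lp.coeFn_smul ((t : ℝ) : ℂ)⁻¹
      (mulOp (fun x => V (Real.exp t • x)) f - mulOp V f),
      Lp.coeFn_sub (mulOp (fun x => V (Real.exp t • x)) f) (mulOp V f),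
      coeFn_mulOp (essBdd_comp_smul hm hC (Real.exp t)) f,
      coeFn_mulOp (essBdd_of_measurable_of_le hm hC) f] with x h1 h2 h3 h4
    rw [h1, Pi.smul_apply, h2, Pi.sub_apply, h3, h4, smul_eq_mul, Real.exp_zero, one_smul]
    ring
  · simp only [mul_pow]
    exact (integrable_norm_sq f).const_mul _
  · filter_upwards [eventually_mem_Icc] with t ht
    refine Eventually.of_forall fun x => ?_
    rw [← sub_mul, norm_mul]
    refine mul_le_mul_of_nonneg_right ((norm_sub_le _ _).trans ?_) (norm_nonneg _)
    have h1 := norm_inv_smul_sub_le (hd x) (hbd x) ht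
    have h2 := hbd x 0 (by norm_num)
    rw [Real.exp_zero, one_smul] at h2
    simp only [Real.exp_zero, one_smul] at h1 ⊢
    linarith
  · refine Eventually.of_forall fun x => ?_
    have := (tendsto_inv_mul_sub (hd x 0)).mul_const (f x)
    simpa only [Real.exp_zero, one_smul] using this

theorem tendsto_inv_smul_exp_sub :
    Tendsto (fun t : ℝ => ((t : ℝ) : ℂ)⁻¹ * (((Real.exp (2 * -t) : ℝ) : ℂ) - 1))
      (𝓝[≠] 0) (𝓝 (-2)) := by
  have h : HasDerivAt (fun t : ℝ => Real.exp (2 * -t)) (-2) 0 := by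
    have := ((hasDerivAt_neg (0 : ℝ)).const_mul 2).exp
    simpa using this
  have := tendsto_inv_mul_sub h.ofReal_comp
  simpa using this

theorem tendsto_dil_of_tendsto {F : ℝ → L2} {g : L2} (h : Tendsto F (𝓝[≠] 0) (𝓝 g)) :
    Tendsto (fun t => dil t (F t)) (𝓝[≠] 0) (𝓝 g) := by
  have h1 : Tendsto (fun t => dil t (F t - g)) (𝓝[≠] 0) (𝓝 0) := by
    rw [tendsto_zero_iff_norm_tendsto_zero]
    simp only [LinearIsometry.norm_map]
    exact tendsto_iff_norm_sub_tendsto_zero.1 h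
  have := h1.add (tendsto_dil g)
  simpa using this

variable {V : Plane → ℝ} {C : ℝ}

/-- The resolvent maps differentiable vectors of the dilation group to differentiable vectors. -/
theorem tendsto_dilQuot_res (hV1 : ContDiff ℝ 1 V) (hC : ∀ x, |V x| ≤ C)
    (hC' : ∀ x, |fderiv ℝ V x x| ≤ C) (hV0 : ∀ x, 0 ≤ V x) {τ : ℝ} (hτ : 0 < τ) {g k : L2}
    (hg : Tendsto (fun t => dilQuot t g) (𝓝[≠] 0) (𝓝 k)) :
    Tendsto (fun t => dilQuot t (res V τ g)) (𝓝[≠] 0)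
      (𝓝 (res V τ (k - (2 : ℂ) • (mulOp V (res V τ g) - (g - (τ : ℂ) • res V τ g)) -
        mulOp (fun x => fderiv ℝ V x x) (res V τ g)))) := by
  have hm := hV1.continuous.measurable
  have hH : IsNonnegSelfAdjoint (negLapV V) :=
    isNonnegSelfAdjoint_negLapV (essBdd_of_measurable_of_le hm hC) hV0
  set u := res V τ g with hu
  set d := mulOp V u - (g - (τ : ℂ) • u) with hd
  have hud : (u, d) ∈ laplacianL2.graph :=
    (mem_graph_negLapV _ _ _).1 (hH.res_mem_graph hτ g)
  -- With U_t the dilation and d = Δu, this vector is U_t applied to t⁻¹(g - (τ + H) U_{-t} u).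
  -- Applying U_t R_τ U_{-t} to it returns exactly the difference quotient of u. Its three terms are
  -- the quotients of g, of the scaling of Δ and of V, each with a known limit.
  have hz : Tendsto (fun t : ℝ => dilQuot t g +
      (((t : ℝ) : ℂ)⁻¹ * (((Real.exp (2 * -t) : ℝ) : ℂ) - 1)) • d -
      ((t : ℝ) : ℂ)⁻¹ • (mulOp (fun x => V (Real.exp t • x)) u - mulOp V u)) (𝓝[≠] 0)
      (𝓝 (k + (-2 : ℂ) • d - mulOp (fun x => fderiv ℝ V x x) u)) :=
    (hg.add (tendsto_inv_smul_exp_sub.smul_const d)).sub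
      (tendsto_inv_smul_mulOp_sub hV1 hC hC' u)
  rw [neg_smul, ← sub_eq_add_neg] at hz
  have hz2 : Tendsto (fun t : ℝ => dil (-t) (dilQuot t g +
      (((t : ℝ) : ℂ)⁻¹ * (((Real.exp (2 * -t) : ℝ) : ℂ) - 1)) • d -
      ((t : ℝ) : ℂ)⁻¹ • (mulOp (fun x => V (Real.exp t • x)) u - mulOp V u))) (𝓝[≠] 0)
      (𝓝 (k - (2 : ℂ) • d - mulOp (fun x => fderiv ℝ V x x) u)) := by
    have := tendsto_dil_of_tendsto (hz.comp tendsto_neg_nhdsNE)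
    have := this.comp tendsto_neg_nhdsNE
    simpa only [Function.comp_def, neg_neg] using this
  refine (tendsto_dil_of_tendsto (((res V τ).continuous.tendsto _).comp hz2)).congr fun t => ?_
  have hV : mulOp V (dil (-t) u) = dil (-t) (mulOp (fun x => V (Real.exp t • x)) u) := by
    have := congrArg (dil (-t)) (dil_mulOp hm hC t (dil (-t) u))
    rwa [dil_neg_dil, dil_dil_neg] at this
  have h1 : (dil (-t) u, mulOp V (dil (-t) u) - ((Real.exp (2 * -t) : ℝ) : ℂ) • dil (-t) d) ∈
      (negLapV V).graph := by
    rw [mem_graph_negLapV, sub_sub_cancel]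
    exact dil_mem_graph_laplacian (-t) hud
  have h2 := hH.res_shift hτ h1
  rw [hV] at h2
  change res V τ _ = _ at h2
  have e : dil (-t) (dilQuot t g +
      (((t : ℝ) : ℂ)⁻¹ * (((Real.exp (2 * -t) : ℝ) : ℂ) - 1)) • d -
      ((t : ℝ) : ℂ)⁻¹ • (mulOp (fun x => V (Real.exp t • x)) u - mulOp V u)) =
      ((t : ℝ) : ℂ)⁻¹ • (g - ((τ : ℂ) • dil (-t) u +
        (dil (-t) (mulOp (fun x => V (Real.exp t • x)) u) -
          ((Real.exp (2 * -t) : ℝ) : ℂ) • dil (-t) d))) := by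
    have hdd : dil (-t) d = dil (-t) (mulOp V u) - (dil (-t) g - (τ : ℂ) • dil (-t) u) := by
      rw [hd, map_sub, map_sub, map_smul]
    unfold dilQuot
    simp only [map_sub, map_add, map_smul, dil_neg_dil]
    rw [mul_smul, ← smul_add, ← smul_sub, sub_smul, one_smul]
    congr 1
    nth_rewrite 2 [hdd]
    abel
  rw [Function.comp_apply, e, map_smul, map_sub, h2, map_smul, map_sub, dil_dil_neg, ← hu]
  rfl

theorem mulOp_potW (hV1 : ContDiff ℝ 1 V) (hC : ∀ x, |V x| ≤ C)
    (hC' : ∀ x, |fderiv ℝ V x x| ≤ C) (hW : EssBdd (potW V)) (f : L2) :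
    mulOp (potW V) f = (2 : ℂ) • mulOp V f + mulOp (fun x => fderiv ℝ V x x) f := by
  have hm := hV1.continuous.measurable
  have hm' : Measurable fun x => fderiv ℝ V x x :=
    ((hV1.continuous_fderiv one_ne_zero).clm_apply continuous_id).measurable
  refine Lp.ext ?_
  filter_upwards [coeFn_mulOp hW f, coeFn_mulOp (essBdd_of_measurable_of_le hm hC) f,
    coeFn_mulOp (essBdd_of_measurable_of_le hm' hC') f,
    Lp.coeFn_add ((2 : ℂ) • mulOp V f) (mulOp (fun x => fderiv ℝ V x x) f),
    Lp.coeFn_smul (2 : ℂ) (mulOp V f)] with x h1 h2 h3 h4 h5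
  rw [h1, h4, Pi.add_apply, h5, Pi.smul_apply, h2, h3, potW, smul_eq_mul]
  push_cast
  ring

/-- The commutator of `x · ∇` with the resolvent, on Schwartz functions. -/
theorem res_mem_graph_xDotGrad (hV1 : ContDiff ℝ 1 V) (hC : ∀ x, |V x| ≤ C)
    (hC' : ∀ x, |fderiv ℝ V x x| ≤ C) (hW : EssBdd (potW V)) (hV0 : ∀ x, 0 ≤ V x) {τ : ℝ}
    (hτ : 0 < τ) (φ : 𝓢(Plane, ℂ)) :
    (res V τ (toL2 φ), res V τ (toL2 (xDG φ)) +
      (2 : ℂ) • res V τ (toL2 φ - (τ : ℂ) • res V τ (toL2 φ)) -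
      res V τ (mulOp (potW V) (res V τ (toL2 φ)))) ∈ xDotGrad.graph := by
  refine mem_graph_xDotGrad_of_tendsto ?_
  have h := tendsto_dilQuot_res hV1 hC hC' hV0 hτ (tendsto_dilQuot_toL2 φ)
  -- With u = R_τ φ the limit contains -2Δu - (x · ∇V)u = 2 H u - W u, where H u = φ - τ u; the
  -- summand φ of the generator produces the extra u.
  convert h using 2
  rw [mulOp_potW hV1 hC hC' hW]
  simp only [map_sub, map_add, map_smul, smul_sub]
  abel

end Commutator

end Schrodinger2D

end

noncomputable section

namespace Schrodinger2D

open Filter Topology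

/-! ### The commutator with the fractional power -/

namespace IsNonnegSelfAdjoint

variable {𝓗 : Type*} [NormedAddCommGroup 𝓗] [InnerProductSpace ℂ 𝓗] [CompleteSpace 𝓗]
  {H : 𝓗 →ₗ.[ℂ] 𝓗}

theorem integrableOn_and_integral_inner_res (hH : IsNonnegSelfAdjoint H) {a : ℝ} (h0 : 0 < a)
    (h1 : a < 1) {f h : 𝓗} (hf : (f, h) ∈ H.graph) (ψ : 𝓗) :
    IntegrableOn (fun τ : ℝ => ((τ ^ (a - 1) : ℝ) : ℂ) * inner ℂ ψ (resolventOp H τ h)) (Ioi 0) ∧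
    ∫ τ in Ioi (0 : ℝ), ((τ ^ (a - 1) : ℝ) : ℂ) * inner ℂ ψ (resolventOp H τ h) =
      ((∫ τ in Ioi (0 : ℝ), τ ^ (a - 1) * (τ + 1)⁻¹ : ℝ) : ℂ) *
        inner ℂ ψ (fracKernel H a (f + h)) := by
  obtain ⟨hI, hE⟩ := hH.integrableOn_and_integral_res h0 h1 hf
  simp only [← inner_smul_right]
  exact ⟨hI.const_inner ψ, by rw [integral_inner hI, hE]⟩

theorem integrableOn_and_integral_inner_res_sq (hH : IsNonnegSelfAdjoint H) {a : ℝ} (h0 : 0 < a)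
    (h1 : a < 1) {f h : 𝓗} (hf : (f, h) ∈ H.graph) (ψ : 𝓗) :
    IntegrableOn (fun τ : ℝ => ((τ ^ a : ℝ) : ℂ) *
      inner ℂ ψ (resolventOp H τ (resolventOp H τ h))) (Ioi 0) ∧
    ∫ τ in Ioi (0 : ℝ), ((τ ^ a : ℝ) : ℂ) * inner ℂ ψ (resolventOp H τ (resolventOp H τ h)) =
      ((a * ∫ τ in Ioi (0 : ℝ), τ ^ (a - 1) * (τ + 1)⁻¹ : ℝ) : ℂ) *
        inner ℂ ψ (fracKernel H a (f + h)) := by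
  obtain ⟨hI, hE⟩ := hH.integrableOn_and_integral_res_sq h0 h1 hf
  simp only [← inner_smul_right]
  exact ⟨hI.const_inner ψ, by rw [integral_inner hI, hE]⟩

end IsNonnegSelfAdjoint

theorem integrableOn_inner_apply {F : ℝ → L2 →L[ℂ] L2} {S : Set ℝ} (hF : IntegrableOn F S)
    (f g : L2) : IntegrableOn (fun τ => inner ℂ f (F τ g)) S :=
  ((innerSL ℂ f) ∘L (ContinuousLinearMap.apply ℂ L2 g)).integrable_comp hF

theorem integral_inner_apply {F : ℝ → L2 →L[ℂ] L2} {S : Set ℝ} (hF : IntegrableOn F S)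
    (f g : L2) : ∫ τ in S, inner ℂ f (F τ g) = inner ℂ f ((∫ τ in S, F τ) g) :=
  ((innerSL ℂ f) ∘L (ContinuousLinearMap.apply ℂ L2 g)).integral_comp_comm hF

theorem inner_integral_apply_comm {F : ℝ → L2 →L[ℂ] L2} {S : Set ℝ} (hS : MeasurableSet S)
    (hF : IntegrableOn F S) (hsymm : ∀ τ ∈ S, ∀ f g : L2, inner ℂ (F τ f) g = inner ℂ f (F τ g))
    (f g : L2) : inner ℂ ((∫ τ in S, F τ) f) g = inner ℂ f ((∫ τ in S, F τ) g) := by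
  rw [← inner_conj_symm, ← integral_inner_apply hF, ← integral_inner_apply hF, ← integral_conj]
  refine setIntegral_congr_fun hS fun τ hτ => ?_
  simp only [inner_conj_symm]
  exact hsymm τ hτ f g

theorem inner_integrand (V : Plane → ℝ) (s τ : ℝ) (f g : L2) :
    inner ℂ f (integrand V s τ g) =
      ((τ ^ (s / 2) : ℝ) : ℂ) * inner ℂ f (res V τ (mulOp (potW V) (res V τ g))) := by
  unfold integrand
  rw [smul_apply, ContinuousLinearMap.comp_apply, ContinuousLinearMap.comp_apply, inner_smul_right]

theorem integrand_symm {V : Plane → ℝ} (hH : IsNonnegSelfAdjoint (negLapV V))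
    (hW : EssBdd (potW V)) (s : ℝ) {τ : ℝ} (hτ : 0 < τ) (f g : L2) :
    inner ℂ (integrand V s τ f) g = inner ℂ f (integrand V s τ g) := by
  unfold integrand res
  simp only [smul_apply, ContinuousLinearMap.comp_apply, inner_smul_right,
    inner_smul_left, Complex.conj_ofReal, hH.inner_res hτ, inner_mulOp hW]

/-- Single-valuedness of the fractional power identifies the vector in the term s H^(s/2) f with the
intermediate vector of the product D H^(s/2). -/
theorem mem_graph_opA (V : Plane → ℝ) (s : ℝ) (f y : L2) :
    (f, y) ∈ (opA V s).graph ↔ ∃ p q g r : L2,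
      (f, p) ∈ (fracPow (negLapV V) (s / 2)).graph ∧ (p, q) ∈ xDotGrad.graph ∧
      (f, g) ∈ xDotGrad.graph ∧ (g, r) ∈ (fracPow (negLapV V) (s / 2)).graph ∧
      (s : ℂ) • p + (q - r) = y := by
  have hq := mem_graph_mulPMap xDotGrad (fracPow (negLapV V) (s / 2)) f
  have hr := mem_graph_mulPMap (fracPow (negLapV V) (s / 2)) xDotGrad f
  unfold opA commutator
  generalize fracPow (negLapV V) (s / 2) = P at *
  generalize mulPMap xDotGrad P = Q at *
  generalize mulPMap P xDotGrad = R at *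
  constructor
  · intro h
    obtain ⟨⟨_, h1, h2, h3⟩, rfl, e⟩ := (LinearPMap.mem_graph_iff _).1 h
    obtain ⟨p, hp, hpq⟩ := (hq _).1 (Q.mem_graph ⟨_, h2⟩)
    obtain ⟨g, hg, hgr⟩ := (hr _).1 (R.mem_graph ⟨_, h3⟩)
    refine ⟨p, _, g, _, hp, hpq, hg, hgr, ?_⟩
    rw [← show _ = y from e, LinearPMap.add_apply, LinearPMap.sub_apply, LinearPMap.smul_apply]
    congr 2
    exact (LinearPMap.mem_graph_snd_inj' P hp (P.mem_graph ⟨_, h1⟩) rfl)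
  · rintro ⟨p, q, g, r, hp, hpq, hg, hgr, rfl⟩
    obtain ⟨⟨_, h1⟩, rfl, e1⟩ := (LinearPMap.mem_graph_iff _).1 hp
    obtain ⟨⟨x2, h2⟩, rfl, e2⟩ := (LinearPMap.mem_graph_iff _).1 ((hq q).2 ⟨p, hp, hpq⟩)
    obtain ⟨⟨x3, h3⟩, rfl, e3⟩ := (LinearPMap.mem_graph_iff _).1 ((hr r).2 ⟨g, hg, hgr⟩)
    refine (LinearPMap.mem_graph_iff _).2 ⟨⟨_, h1, h2, h3⟩, rfl, ?_⟩
    rw [LinearPMap.add_apply, LinearPMap.sub_apply, LinearPMap.smul_apply]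
    simp only at e1 e2 e3
    rw [← e1, ← e2, ← e3]

section FracCommutator

variable {V : Plane → ℝ} {C s : ℝ}

/-- The commutator of `x · ∇` with the fractional power, on Schwartz functions. -/
theorem fracKernel_mem_graph_xDotGrad (hV1 : ContDiff ℝ 1 V) (hC : ∀ x, |V x| ≤ C)
    (hC' : ∀ x, |fderiv ℝ V x x| ≤ C) (hW : EssBdd (potW V)) (hV0 : ∀ x, 0 ≤ V x)
    (hH : IsNonnegSelfAdjoint (negLapV V)) (hs0 : 0 < s) (hs2 : s < 2)
    (hI : IntegrableOn (fun τ : ℝ => integrand V s τ) (Ioi 0)) {φ : 𝓢(Plane, ℂ)} {h h' : L2}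
    (hφ : (toL2 φ, h) ∈ (negLapV V).graph) (hφ' : (toL2 (xDG φ), h') ∈ (negLapV V).graph) :
    (fracKernel (negLapV V) (s / 2) (toL2 φ + h),
      fracKernel (negLapV V) (s / 2) (toL2 (xDG φ) + h') -
        (s : ℂ) • fracKernel (negLapV V) (s / 2) (toL2 φ + h) +
        ((cConst s : ℝ) : ℂ) • (∫ τ in Ioi (0 : ℝ), integrand V s τ) (toL2 φ)) ∈
      xDotGrad.graph := by
  have h0 : 0 < s / 2 := by linarith
  have h1 : s / 2 < 1 := by linarith
  rw [mem_graph_xDotGrad]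
  intro ψ
  obtain ⟨i1, e1⟩ := hH.integrableOn_and_integral_inner_res h0 h1 hφ (toL2 (xDGadj ψ))
  obtain ⟨i2, e2⟩ := hH.integrableOn_and_integral_inner_res h0 h1 hφ' (toL2 ψ)
  obtain ⟨i3, e3⟩ := hH.integrableOn_and_integral_inner_res_sq h0 h1 hφ (toL2 ψ)
  have i4 := integrableOn_inner_apply hI (toL2 ψ) (toL2 φ)
  have e4 := integral_inner_apply hI (toL2 ψ) (toL2 φ)
  -- The unbounded D is kept on the test function as its formal adjoint, so only scalar functions
  -- are integrated. Pointwise this is [D, R_τ H] = -τ [D, R_τ], and the factor τ raises the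
  -- exponent from s/2 - 1 to s/2.
  have hpt : ∀ τ ∈ Ioi (0 : ℝ), ((τ ^ (s / 2 - 1) : ℝ) : ℂ) *
      inner ℂ (toL2 (xDGadj ψ)) (resolventOp (negLapV V) τ h) =
      ((τ ^ (s / 2 - 1) : ℝ) : ℂ) * inner ℂ (toL2 ψ) (resolventOp (negLapV V) τ h') -
      2 * (((τ ^ (s / 2) : ℝ) : ℂ) *
        inner ℂ (toL2 ψ) (resolventOp (negLapV V) τ (resolventOp (negLapV V) τ h))) +
      inner ℂ (toL2 ψ) (integrand V s τ (toL2 φ)) := by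
    intro τ hτ
    have hτ' : (0 : ℝ) < τ := hτ
    have hR : resolventOp (negLapV V) τ h = toL2 φ - (τ : ℂ) • res V τ (toL2 φ) := by
      have := hH.res_shift hτ' hφ
      rw [map_add, map_smul] at this
      exact eq_sub_of_add_eq' this
    have hR' : resolventOp (negLapV V) τ h' = toL2 (xDG φ) - (τ : ℂ) • res V τ (toL2 (xDG φ)) := by
      have := hH.res_shift hτ' hφ'
      rw [map_add, map_smul] at this
      exact eq_sub_of_add_eq' this
    have hg := (mem_graph_xDotGrad _ _).1
      (res_mem_graph_xDotGrad hV1 hC hC' hW hV0 hτ' φ) ψ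
    have hp : τ ^ (s / 2) = τ ^ (s / 2 - 1) * τ := by
      rw [← Real.rpow_add_one hτ'.ne', sub_add_cancel]
    rw [← hR, inner_sub_right, inner_add_right, inner_smul_right] at hg
    have hL : inner ℂ (toL2 (xDGadj ψ)) (resolventOp (negLapV V) τ h) =
        inner ℂ (toL2 ψ) (toL2 (xDG φ)) - (τ : ℂ) *
          inner ℂ (toL2 (xDGadj ψ)) (res V τ (toL2 φ)) := by
      rw [hR, inner_sub_right, inner_smul_right, inner_xDGadj]
    rw [hL, hg, hR', inner_sub_right, inner_smul_right, hp, inner_integrand, hp]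
    change _ = _ - 2 * (_ * inner ℂ (toL2 ψ) (res V τ (resolventOp (negLapV V) τ h))) + _
    push_cast
    ring
  -- Integrating, the middle term contributes 2 · (s/2) = s times the fractional power, which is the
  -- subtracted term of the claim.
  have hsum := integral_add (i2.sub (i3.const_mul 2)) i4
  simp only [Pi.sub_apply] at hsum
  rw [setIntegral_congr_fun measurableSet_Ioi hpt, hsum, integral_sub i2 (i3.const_mul 2),
    integral_const_mul, e2, e3, e4] at e1
  have hne : ((∫ τ in Ioi (0 : ℝ), τ ^ (s / 2 - 1) * (τ + 1)⁻¹ : ℝ) : ℂ) ≠ 0 :=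
    Complex.ofReal_ne_zero.2 (integral_rpow_mul_inv_pos h0 h1).ne'
  rw [inner_add_right, inner_sub_right, inner_smul_right, inner_smul_right, cConst,
    Complex.ofReal_inv]
  refine mul_left_cancel₀ hne ?_
  rw [← e1, mul_add, mul_inv_cancel_left₀ hne, Complex.ofReal_mul, Complex.ofReal_div,
    Complex.ofReal_ofNat]
  ring

/-- Decay of order 2 is all that the form bound needs, since its weights (1 + |x|²)^(-1+ε) decay
more slowly. -/
theorem abs_le_of_decay {β : ℝ} (hC : 0 < C) (hβ : 3 < β)
    (hd : ∀ x, |V x| + |fderiv ℝ V x x| ≤ C / (Real.sqrt (1 + ‖x‖ ^ 2)) ^ β) (x : Plane) :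
    |V x| + |fderiv ℝ V x x| ≤ C * weight (-1) x := by
  refine (hd x).trans ?_
  have h1 : 1 ≤ Real.sqrt (1 + ‖x‖ ^ 2) := Real.one_le_sqrt.2 (by nlinarith [sq_nonneg ‖x‖])
  have h2 : 1 + ‖x‖ ^ 2 ≤ Real.sqrt (1 + ‖x‖ ^ 2) ^ β := by
    calc 1 + ‖x‖ ^ 2 = Real.sqrt (1 + ‖x‖ ^ 2) ^ (2 : ℝ) := by
          rw [Real.rpow_two, Real.sq_sqrt (by positivity)]
      _ ≤ _ := Real.rpow_le_rpow_of_exponent_le h1 (by linarith)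
  rw [weight, Real.rpow_neg_one, ← div_eq_mul_inv]
  gcongr

end FracCommutator

end Schrodinger2D

end

/-! ### Assembly: the formula on Schwartz functions, then on the whole domain by duality. -/

theorem proposition2p2 (V : Schrodinger2D.Plane → ℝ) (C β : ℝ) (hC : 0 < C) (hβ : 3 < β)
    (hV_smooth : ContDiff ℝ 1 V)
    (hV_decay : ∀ x, |V x| + |fderiv ℝ V x x| ≤ C / (Real.sqrt (1 + ‖x‖ ^ 2)) ^ β)
    (hV_nonneg : ∀ x, 0 ≤ V x)
    (s : ℝ) (hs0 : 0 < s) (hs2 : s < 2) :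
    -- each resolvent in the formula is the bounded inverse of `τ - Δ_V`
    (∀ τ : ℝ, 0 < τ →
      Schrodinger2D.IsResolvent (Schrodinger2D.negLapV V) τ (Schrodinger2D.res V τ)) ∧
    -- the integral defining `c(s)` converges
    IntegrableOn (fun τ : ℝ => τ ^ (s / 2 - 1) * (τ + 1)⁻¹) (Ioi 0) ∧
    -- the operator-valued integral converges absolutely in the operator norm of `L²`
    IntegrableOn (fun τ : ℝ => Schrodinger2D.integrand V s τ) (Ioi 0) ∧
    -- `A(s)` is densely defined: its domain contains the Schwartz functions
    (∀ φ : 𝓢(Schrodinger2D.Plane, ℂ), φ.toLp 2 volume ∈ (Schrodinger2D.opA V s).domain) ∧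
    -- the formula
    ∀ f : (Schrodinger2D.opA V s).domain,
      Schrodinger2D.opA V s f =
        ((Schrodinger2D.cConst s : ℝ) : ℂ) •
          (∫ τ in Ioi (0 : ℝ), Schrodinger2D.integrand V s τ) (f : Schrodinger2D.L2) := by
  open Schrodinger2D in
  have hdec := abs_le_of_decay hC hβ hV_decay
  have hdC : ∀ x, |V x| + |fderiv ℝ V x x| ≤ C := fun x =>
    (hdec x).trans (mul_le_of_le_one_right hC.le (weight_le_one (by norm_num) x))
  have hVC : ∀ x, |V x| ≤ C := fun x => by linarith [hdC x, abs_nonneg (fderiv ℝ V x x)]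
  have hVC' : ∀ x, |fderiv ℝ V x x| ≤ C := fun x => by linarith [hdC x, abs_nonneg (V x)]
  have hmV := hV_smooth.continuous.measurable
  have hmW : Measurable (potW V) := (hV_smooth.continuous.const_mul 2 |>.add
    ((hV_smooth.continuous_fderiv one_ne_zero).clm_apply continuous_id)).measurable
  have hVb := essBdd_of_measurable_of_le hmV hVC
  have hWle : ∀ x, |potW V x| ≤ 2 * C * weight (-1) x := fun x => by
    have h1 : |potW V x| ≤ |2 * V x| + |fderiv ℝ V x x| := abs_add_le _ _
    rw [abs_mul, abs_two] at h1
    linarith [hdec x, abs_nonneg (fderiv ℝ V x x)]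
  have hWb : EssBdd (potW V) := essBdd_of_measurable_of_le hmW fun x =>
    (hWle x).trans (mul_le_of_le_one_right (by positivity) (weight_le_one (by norm_num) x))
  have hH := isNonnegSelfAdjoint_negLapV hVb hV_nonneg
  have h0 : 0 < s / 2 := by linarith
  have h1 : s / 2 < 1 := by linarith
  have hI := integrableOn_integrand_of_bounds hVb hV_nonneg hmW hs0 hs2 hWle
  have hS : ∀ φ : 𝓢(Plane, ℂ), ∃ p q r : L2,
      (toL2 φ, p) ∈ (fracPow (negLapV V) (s / 2)).graph ∧ (p, q) ∈ xDotGrad.graph ∧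
      (toL2 (xDG φ), r) ∈ (fracPow (negLapV V) (s / 2)).graph ∧
      q = r - (s : ℂ) • p + ((cConst s : ℝ) : ℂ) •
        (∫ τ in Ioi (0 : ℝ), integrand V s τ) (toL2 φ) := fun φ =>
    ⟨_, _, _, hH.mem_graph_fracPow_of_mem_graph h0 h1 (toL2_mem_graph_negLapV V φ),
      fracKernel_mem_graph_xDotGrad hV_smooth hVC hVC' hWb hV_nonneg hH hs0 hs2 hI
        (toL2_mem_graph_negLapV V φ) (toL2_mem_graph_negLapV V (xDG φ)),
      hH.mem_graph_fracPow_of_mem_graph h0 h1 (toL2_mem_graph_negLapV V (xDG φ)), rfl⟩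
  refine ⟨fun τ hτ => hH.isResolvent hτ, integrableOn_rpow_mul_inv h0 h1, hI, fun φ => ?_,
    fun f => ?_⟩
  · obtain ⟨p, q, r, hp, hpq, hr, -⟩ := hS φ
    exact (opA V s).mem_domain_of_mem_graph ((mem_graph_opA V s _ _).2
      ⟨p, q, _, r, hp, hpq, toL2_mem_graph_xDotGrad φ, hr, rfl⟩)
  · obtain ⟨p, q, g, r, hp, hpq, hg, hgr, e⟩ :=
      (mem_graph_opA V s _ _).1 ((opA V s).mem_graph f)
    rw [← e]
    -- Everything is moved onto ψ: D by its adjoint relations (`a1`, `a5`), the fractional power by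
    -- symmetry (`a2`, `a3`, `a4`) and the operator integral by `hT`. The formula already known for
    -- ψ is `e'`. The extra multiples of the identity in D* = -D - 2 occur in both `a1` and `a5` and
    -- cancel.
    refine eq_of_inner_toL2 fun ψ => ?_
    obtain ⟨p', q', r', hp', hpq', hr', e'⟩ := hS ψ
    have hT := inner_integral_apply_comm measurableSet_Ioi hI
      (fun τ hτ => integrand_symm hH hWb s hτ) (toL2 ψ) f
    have a1 := (mem_graph_xDotGrad _ _).1 hpq ψ
    have a2 := hH.fracPow_symm h0 h1 hr' hp
    have a3 := hH.fracPow_symm h0 h1 hp' hp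
    have a4 := hH.fracPow_symm h0 h1 hp' hgr
    have a5 := inner_xDotGrad hg hpq'
    rw [e', inner_add_left, inner_sub_left, inner_smul_left, inner_smul_left, Complex.conj_ofReal,
      Complex.conj_ofReal, hT, a2, a3] at a5
    unfold xDGadj at a1
    rw [map_sub, map_neg, map_smul, inner_sub_left, inner_neg_left, inner_smul_left,
      Complex.conj_ofNat] at a1
    rw [inner_add_right, inner_sub_right, inner_smul_right, inner_smul_right, ← a1, ← a4, a5]
    ring
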